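/- **Setting.** Coefficient functions are sequences $\epsilon=(\epsilon_1,\epsilon_2,\dots)$ of non-negative integers; $\beta^i$ denotes the one with $1$ at index $i$ and $0$ elsewhere. Let $L=(e_1,\dots,e_N)$ be a list of non-negative integers with $N\ge 2$, $e_1\ne 0$. For $n\ge1$ let $\bar\beta^n$ be the coefficient function that is $0$ before index $n$ and continues $e_1,\dots,e_N,e_1,\dots,e_N,\dots$ from index $n$ on. For $p\ge 1$ let $\theta=(\bar\beta^1_p,\bar\beta^1_{p-1},\dots,\bar\beta^1_1,0,0,\dots)$. An *$L$-block* at index $p$ is either $\theta$ (support interval $[1,p]$), or, for some $1\le k\le p$, a $\zeta$ with $\zeta_j=\theta_j$ for $j>k$, $\zeta_k<\theta_k$, $\zeta_j=0$ for $j<k$ (support interval $[k,p]$). A *proper $L^*$-block* with support interval $[n,k]$, $1\le n\le k$, is a $\zeta$ with $\zeta_j=\bar\beta^n_j$ for $j<k$, $\zeta_k<\bar\beta^n_k$, $\zeta_j=0$ for $j>k$. Blocks are disjoint if their support intervals are. Let $\mathcal E$ be the set of finite sums of disjoint $L$-blocks, and $\mathcal E^*$ the set of non-zero finite or infinite sums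 of disjoint proper $L^*$-blocks. Let $S_0=\{0\}$, and for $b\ge 1$ let $S_b$ be the set of finite sums (possibly equal to $0$) of disjoint proper $L^*$-blocks the last of which has a support interval ending at $b$; put $C_b=\#S_b$. Let $$\overline{\mathcal E^*}=\mathcal E^*\cup\{\epsilon^0+\bar\beta^{b+1}: b\ge 0,\ \epsilon^0\in S_b\}.$$ Let $\widetilde{\mathcal E},\widetilde{\mathcal E}^*$ be the collections determined in the same way by a second list $\widetilde L=(\widetilde e_1,\dots,\widetilde e_M)$ with $M\ge2$, $\widetilde e_1\neq0$, and assume $\mathcal E\subsetneq\widetilde{\mathcal E}$. Let $\widetilde\omega>0$ be the positive zero of $1-\sum_{k=1}^{M-1}\widetilde e_kx^k-(1+\widetilde e_M)x^M$, let $\widetilde Q_k=\widetilde\omega^k$, and write $\sum\epsilon\widetilde Q=\sum_{k\ge1}\epsilon_k\widetilde\omega^k$. Let $$U=\Big\{\sum\tau\widetilde Q:\ \tau\in\widetilde{\mathcal E}^*\setminus\overline{\mathcal E^*}\Big\},\qquad f(x)=1-\sum_{k=1}^{N-1}e_kx^k-(1+e_N)x^N,\qquad \rho=\sum\bar\beta^1\widetilde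 Q .$$ **Theorem.** 0. $\widetilde Q$ is a fundamental sequence of $\widetilde{\mathcal E}^*$: it is strictly decreasing in $(0,1)$, and $\epsilon\mapsto\sum\epsilon\widetilde Q$ is a bijection of $\widetilde{\mathcal E}^*$ onto $(0,1)$ that is increasing for the lexicographical order ($\epsilon<\delta$ iff $\epsilon_k<\delta_k$ at the first index $k$ at which they differ). 1. Every $\epsilon\in\overline{\mathcal E^*}\setminus\mathcal E^*$ is $\epsilon^0+\bar\beta^{b+1}$ for exactly one pair $(b,\epsilon^0)$ with $b\ge0$, $\epsilon^0\in S_b$. Put $x_\epsilon=\sum\epsilon\widetilde Q$ and $x'_\epsilon=\sum(\epsilon^0+\beta^b)\widetilde Q$, to be read as $x'_\epsilon=1$ if $b=0$; if $b\ge 1$ then $\epsilon^0+\beta^b\in\mathcal E^*$. The open intervals $(x_\epsilon,x'_\epsilon)$, $\epsilon\in\overline{\mathcal E^*}\setminus\mathcal E^*$, are non-empty and pairwise disjoint, and $$U\setminus\{x_\epsilon:\epsilon\in\overline{\mathcal E^*}\setminus\mathcal E^*\}=\bigcup_{\epsilon\in\overline{\mathcal E^*}\setminus\mathcal E^*}(x_\epsilon,x'_\epsilon).$$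 If $\bar\beta^1\in\widetilde{\mathcal E}^*$ (in particular, if $\overline{\mathcal E^*}\subset\widetilde{\mathcal E}^*$), then $U$ itself equals this disjoint union, and $U$ is open. 2. $U$ is (Borel) measurable and has Lebesgue measure $1$. 3. The sets $S_n$ are finite, $C_0=1$, and $$C_k=e_1C_{k-1}+\dots+e_kC_0\quad(1\le k\le N),\qquad C_n=\sum_{k=1}^{N-1}e_kC_{n-k}+(1+e_N)C_{n-N}\quad(n\ge N+1).$$ There is $r>\widetilde\omega$ such that $f(x)\ne0$ and $\sum_{k\ge0}C_kx^k=(1-x^N)/f(x)$ for all real $x$ with $|x|<r$. 4. Put $I_b=\widetilde\omega^b-\sum\bar\beta^{b+1}\widetilde Q$. Then $I_b=\widetilde\omega^b(1-\rho)$; if $\epsilon=\epsilon^0+\bar\beta^{b+1}$ as in 1, then $x'_\epsilon-x_\epsilon=I_b$; for each $b\ge0$ exactly $C_b$ of the elements $\epsilon\in\overline{\mathcal E^*}\setminus\mathcal E^*$ have $x'_\epsilon-x_\epsilon=I_b$; and $$\sum_{b\ge0}C_bI_b=(1-\rho)\,\frac{1-\widetilde\omega^N}{f(\widetilde\omega)}=1.$$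 -/

import Mathlib

open Set Filter Topology MeasureTheory

/-!
Conventions. A coefficient function `(ε₁, ε₂, …)` is a function `ε : ℕ → ℕ` whose entry at the
unused index `0` is `0`; the definitions of blocks below force `ε 0 = 0` for every coefficient
function that occurs. A list `L = (e₁, …, e_N)` is given by `N : ℕ` and `e : ℕ → ℕ`; only the
values `e 1, …, e N` are ever used.
-/

namespace Zeck

/-- The basis coefficient function `β^i`. -/
def basis (i : ℕ) : ℕ → ℕ := fun k => if k = i then 1 else 0

/-- `res_m(ε)`: keep the entries with index at most `m`. -/
def res (m : ℕ) (ε : ℕ → ℕ) : ℕ → ℕ := fun k => if k ≤ m then ε k else 0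

/-- `rev_n(ε) = (ε_n, ε_{n-1}, …, ε_1)`. -/
def rev (n : ℕ) (ε : ℕ → ℕ) : ℕ → ℕ := fun k => if 1 ≤ k ∧ k ≤ n then ε (n + 1 - k) else 0

/-- The maximal `L^*`-block at index `n ≥ 1`: zero before `n`, and then
`e₁, …, e_N, e₁, …, e_N, …`. -/
def maxBlock (N : ℕ) (e : ℕ → ℕ) (n : ℕ) : ℕ → ℕ :=
  fun k => if n ≤ k then e ((k - n) % N + 1) else 0

/-- The descending lexicographical order `ε <_d δ`. -/
def DescLT (ε δ : ℕ → ℕ) : Prop := ∃ k, (∀ j < k, ε j = δ j) ∧ ε k < δ k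

/-- `ζ m`, for `m ∈ I`, are blocks with support intervals `[i m, b m]`, and these intervals are
pairwise disjoint. Here `P i b ζ` says that `ζ` is a block with support interval `[i, b]`. -/
def IsDisjointFamily (P : ℕ → ℕ → (ℕ → ℕ) → Prop) (I : Set ℕ) (ζ : ℕ → ℕ → ℕ)
    (i b : ℕ → ℕ) : Prop :=
  (∀ m ∈ I, P (i m) (b m) (ζ m)) ∧
    I.Pairwise fun m m' => Disjoint (Set.Icc (i m) (b m)) (Set.Icc (i m') (b m'))

/-! ### Collections for positive integers -/

/-- `ζ` is a proper `L`-block at index `p` with support interval `[k, p]`; the maximal `L`-block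
at index `p` is `rev_p(e₁, …, e_N, e₁, …, e_N, …)`. -/
def IsProperBlock (N : ℕ) (e : ℕ → ℕ) (k p : ℕ) (ζ : ℕ → ℕ) : Prop :=
  1 ≤ k ∧ k ≤ p ∧ (∀ j, k < j → ζ j = rev p (maxBlock N e 1) j) ∧
    ζ k < rev p (maxBlock N e 1) k ∧ ∀ j < k, ζ j = 0

/-- `ζ` is the maximal `L`-block at index `p ≥ 1`; its support interval is `[1, p]`. -/
def IsMaximalBlock (N : ℕ) (e : ℕ → ℕ) (k p : ℕ) (ζ : ℕ → ℕ) : Prop :=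
  k = 1 ∧ 1 ≤ p ∧ ζ = rev p (maxBlock N e 1)

/-- `ζ` is an `L`-block with support interval `[k, p]`. -/
def IsBlock (N : ℕ) (e : ℕ → ℕ) (k p : ℕ) (ζ : ℕ → ℕ) : Prop :=
  IsProperBlock N e k p ζ ∨ IsMaximalBlock N e k p ζ

/-- The periodic Zeckendorf collection `E` for positive integers determined by `L`:
the finite sums of disjoint `L`-blocks. -/
def coll (N : ℕ) (e : ℕ → ℕ) : Set (ℕ → ℕ) :=
  {ε | ∃ (I : Finset ℕ) (ζ : ℕ → ℕ → ℕ) (i b : ℕ → ℕ),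
    IsDisjointFamily (IsBlock N e) I ζ i b ∧ ε = ∑ m ∈ I, ζ m}

/-! ### Collections for the unit interval -/

/-- `ζ` is a proper `L^*`-block at index `n` with support interval `[n, k]`. -/
def IsProperStarBlock (N : ℕ) (e : ℕ → ℕ) (n k : ℕ) (ζ : ℕ → ℕ) : Prop :=
  1 ≤ n ∧ n ≤ k ∧ (∀ j < k, ζ j = maxBlock N e n j) ∧ ζ k < maxBlock N e n k ∧
    ∀ j, k < j → ζ j = 0

/-- The periodic Zeckendorf collection `E^*` for the unit interval determined by `L`: the non-zero
finite or infinite sums of disjoint proper `L^*`-blocks. (For each `k` at most one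
summand of the entry at `k` is non-zero.) -/
def starColl (N : ℕ) (e : ℕ → ℕ) : Set (ℕ → ℕ) :=
  {ε | ε ≠ 0 ∧ ∃ (I : Set ℕ) (ζ : ℕ → ℕ → ℕ) (i b : ℕ → ℕ),
    IsDisjointFamily (IsProperStarBlock N e) I ζ i b ∧ ∀ k, ε k = ∑ᶠ m ∈ I, ζ m k}

/-- The set `S_n`: for `n ≥ 1` the finite sums of disjoint proper `L^*`-blocks the last of which
has a support interval of the form `[i, n]`, and `S_0 = {0}`. -/
def blockSums (N : ℕ) (e : ℕ → ℕ) (n : ℕ) : Set (ℕ → ℕ) :=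
  {ε | (n = 0 ∧ ε = 0) ∨ ∃ (I : Finset ℕ) (ζ : ℕ → ℕ → ℕ) (i b : ℕ → ℕ),
    IsDisjointFamily (IsProperStarBlock N e) I ζ i b ∧ (∀ m ∈ I, b m ≤ n) ∧
      (∃ m ∈ I, b m = n) ∧ ε = ∑ m ∈ I, ζ m}

/-- The block-counting sequence `C_n = #S_n`. -/
noncomputable def blockCount (N : ℕ) (e : ℕ → ℕ) (n : ℕ) : ℕ := (blockSums N e n).ncard

/-- The closure of `E^*`: the union of `E^*` and the set of all `∑_{m ≤ ℓ} ζ^m + \bar β^{b+1}`, where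
`ζ^m` are disjoint proper `L^*`-blocks and the support interval of the last one ends at `b`
(`ℓ = 0` and `b = 0` being allowed). -/
def starClosure (N : ℕ) (e : ℕ → ℕ) : Set (ℕ → ℕ) :=
  starColl N e ∪ {ε | ∃ b, ∃ ε₀ ∈ blockSums N e b, ε = ε₀ + maxBlock N e (b + 1)}

/-- The index `b` of a decomposition `ε = ε₀ + \bar β^{b+1}` with `ε₀ ∈ S_b`
(there is only one such `b`). -/
noncomputable def tailIndex (N : ℕ) (e : ℕ → ℕ) (ε : ℕ → ℕ) : ℕ :=
  sInf {b | ∃ ε₀ ∈ blockSums N e b, ε = ε₀ + maxBlock N e (b + 1)}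

/-! ### Evaluation -/

/-- `∑ ε Q`. -/
noncomputable def eval (Q : ℕ → ℝ) (ε : ℕ → ℕ) : ℝ := ∑' k, (ε k : ℝ) * Q k

/-- `f(x) = 1 - ∑_{k=1}^{N-1} e_k x^k - (1 + e_N) x^N`. -/
noncomputable def charFun (N : ℕ) (e : ℕ → ℕ) (x : ℝ) : ℝ :=
  1 - ∑ k ∈ Finset.Icc 1 (N - 1), (e k : ℝ) * x ^ k - (1 + (e N : ℝ)) * x ^ N

/-- `Q₁, Q₂, …` is a decreasing sequence in `(0,1)` for which evaluation is an increasing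
bijection of the collection `A` onto `(0,1)`. -/
structure IsFundamentalSequence (A : Set (ℕ → ℕ)) (Q : ℕ → ℝ) : Prop where
  mem : ∀ n, 1 ≤ n → Q n ∈ Set.Ioo (0 : ℝ) 1
  anti : ∀ n, 1 ≤ n → Q (n + 1) < Q n
  summable : ∀ ε ∈ A, Summable fun k => (ε k : ℝ) * Q k
  bij : Set.BijOn (eval Q) A (Set.Ioo (0 : ℝ) 1)
  increasing : ∀ ε ∈ A, ∀ δ ∈ A, DescLT ε δ ↔ eval Q ε < eval Q δ

/-- The sequence `ω, ω², ω³, …`, with value `1` at the unused index `0`. -/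
def powers (ω : ℝ) : ℕ → ℝ := fun k => ω ^ k

/-- The left end point `x_ε = ∑ ε Q`, where `Q_k = ω^k`. -/
noncomputable def leftEnd (ω : ℝ) (ε : ℕ → ℕ) : ℝ := eval (powers ω) ε

/-- The right end point `x'_ε = ∑ (ε₀ + β^b) Q` for `ε = ε₀ + \bar β^{b+1}`, `ε₀ ∈ S_b`, where
`Q_k = ω^k`; here `ε₀ = res_b(ε)`. If `b = 0`, then the value is `ω^0 = 1`. -/
noncomputable def rightEnd (N : ℕ) (e : ℕ → ℕ) (ω : ℝ) (ε : ℕ → ℕ) : ℝ :=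
  eval (powers ω) (res (tailIndex N e ε) ε + basis (tailIndex N e ε))

/-- The set `U`: the image under evaluation of the members of the collection determined by
`(e'₁, …, e'_M)` which do not belong to the closure of `E^*`. -/
def setU (N : ℕ) (e : ℕ → ℕ) (M : ℕ) (e' : ℕ → ℕ) (ω : ℝ) : Set ℝ :=
  eval (powers ω) '' (starColl M e' \ starClosure N e)

/-- `I_b = ω^b - ∑ \bar β^{b+1} Q`, where `Q_k = ω^k`. -/
noncomputable def gapLength (N : ℕ) (e : ℕ → ℕ) (ω : ℝ) (b : ℕ) : ℝ :=
  ω ^ b - eval (powers ω) (maxBlock N e (b + 1))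

/-- `ρ = ∑ \bar β^1 Q`, where `Q_k = ω^k`. -/
noncomputable def rho (N : ℕ) (e : ℕ → ℕ) (ω : ℝ) : ℝ := eval (powers ω) (maxBlock N e 1)

end Zeck

/-! ### Parsing a digit sequence into blocks -/

namespace Zeck

/-! Membership in every collection is a property of one left-to-right parse. A block copies the
maximal sequence `B = dig N e` until a smaller digit completes it, and `st` counts the digits copied
so far; a sequence is accepted when no digit exceeds the one due. The closure of E^* is the set of
non-zero accepted sequences, E^* the set of those with infinitely many block ends, and their
difference consists of the sequences that run into an uncompleted maximal block (`IsTail`). Reversed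
elements of E are accepted finite words, so the inclusion of the collections says that the larger
parser accepts whatever the smaller one accepts. Its strictness serves only to make the two maximal
sequences different.

At the root of its characteristic function the maximal sequence of the larger collection has value
1: one unit at index k equals a maximal block after k. Hence a tail never exceeds what its state
permits (`IsBase.tailVal_le`), evaluation respects the lexicographical order, and a greedy expansion
reaches every value.

Let ε run into a maximal block from index b+1 on. A B-accepted sequence above ε has at least the
value of ε^0+β^b (`IsTail.right_le_of_descLT`), so the interval belonging to ε is a gap in the
values of the closure. Conversely, a member of the larger collection outside the closure breaks the
smaller parse at some first digit; returning to the last block end and continuing maximally from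
there gives the gap that contains its value (`exists_isTail_of_not_isAccepted`). So U is the union
of the gaps, up to countably many left end points.

There are C_b gaps of length ω^b(1-ρ). Splitting off the last block gives the renewal equation
`blockCount_succ`. If g is the generating function of the maximal block, then ∑ C_k x^k = 1/(1-g)
and f = (1-x^N)(1-g); since g = ρ at ω, the total length is 1. -/

/-- The periodic digit sequence `e₁, …, e_N, e₁, …`, indexed from `0`. -/
def dig (N : ℕ) (e : ℕ → ℕ) : ℕ → ℕ := fun s => e (s % N + 1)

/-- The number of digits read since the last completed proper block, after reading
`τ 1, …, τ k`; a block copies `B 0, B 1, …` until it is completed by a smaller digit. -/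
def st (B τ : ℕ → ℕ) : ℕ → ℕ
  | 0 => 0
  | k + 1 => if τ (k + 1) < B (st B τ k) then 0 else st B τ k + 1

/-- The digits `τ 1, …, τ p` can be parsed into blocks. -/
def IsAcceptedUpTo (B τ : ℕ → ℕ) (p : ℕ) : Prop := ∀ k < p, τ (k + 1) ≤ B (st B τ k)

/-- All digits of `τ` can be parsed into blocks. -/
def IsAccepted (B τ : ℕ → ℕ) : Prop := τ 0 = 0 ∧ ∀ k, τ (k + 1) ≤ B (st B τ k)

variable {B τ σ : ℕ → ℕ}

@[simp] theorem st_zero : st B τ 0 = 0 := rfl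

theorem st_succ (k : ℕ) :
    st B τ (k + 1) = if τ (k + 1) < B (st B τ k) then 0 else st B τ k + 1 := rfl

theorem st_succ_of_lt {k : ℕ} (h : τ (k + 1) < B (st B τ k)) : st B τ (k + 1) = 0 := by
  rw [st_succ, if_pos h]

theorem st_succ_of_ge {k : ℕ} (h : B (st B τ k) ≤ τ (k + 1)) :
    st B τ (k + 1) = st B τ k + 1 := by
  rw [st_succ, if_neg (not_lt.mpr h)]

theorem st_succ_eq_zero_iff {k : ℕ} : st B τ (k + 1) = 0 ↔ τ (k + 1) < B (st B τ k) := by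
  rw [st_succ]; split_ifs with h <;> simp [h]

theorem st_congr {p : ℕ} (h : ∀ j, 1 ≤ j → j ≤ p → τ j = σ j) :
    ∀ k ≤ p, st B τ k = st B σ k := by
  intro k hk
  induction k with
  | zero => rfl
  | succ k ih => rw [st_succ, st_succ, ih (by omega), h (k + 1) (by omega) hk]

theorem IsAcceptedUpTo.congr {p : ℕ} (hτ : IsAcceptedUpTo B τ p)
    (h : ∀ j, 1 ≤ j → j ≤ p → τ j = σ j) : IsAcceptedUpTo B σ p := by
  intro k hk
  rw [← h (k + 1) (by omega) hk, ← st_congr h k hk.le]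
  exact hτ k hk

theorem st_add {a : ℕ} (h : st B τ a = 0) (k : ℕ) :
    st B τ (a + k) = st B (fun j => τ (a + j)) k := by
  induction k with
  | zero => simpa using h
  | succ k ih => rw [← add_assoc, st_succ, st_succ, ih, ← add_assoc]

theorem st_le (k : ℕ) : st B τ k ≤ k := by
  induction k with
  | zero => simp
  | succ k ih => rw [st_succ]; split_ifs <;> omega

/-- The unfinished block at `k` began right after index `k - st B τ k`, and the state has counted
upwards since. With `j = 0` this exhibits the last block end at or before `k`. -/
theorem st_sub_add (k : ℕ) : ∀ j ≤ st B τ k, st B τ (k - st B τ k + j) = j := by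
  induction k with
  | zero => intro j hj; simp at hj; simp [hj]
  | succ k ih =>
    intro j hj
    rcases lt_or_ge (τ (k + 1)) (B (st B τ k)) with h | h
    · rw [st_succ_of_lt h] at hj ⊢
      obtain rfl : j = 0 := by omega
      simpa using st_succ_of_lt h
    · have hs := st_succ_of_ge h
      have hle := st_le (B := B) (τ := τ) k
      rcases Nat.lt_or_ge (st B τ k) j with hj' | hj'
      · obtain rfl : j = st B τ k + 1 := by omega
        rw [hs, show k + 1 - (st B τ k + 1) + (st B τ k + 1) = k + 1 by omega, hs]
      · rw [hs, show k + 1 - (st B τ k + 1) = k - st B τ k by omega]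
        exact ih j hj'

/-- Acceptance forbids a larger digit, and a smaller one would have completed the block. -/
theorem IsAcceptedUpTo.eq_of_lt_st {k j : ℕ} (hτ : IsAcceptedUpTo B τ k) (hj : j < st B τ k) :
    τ (k - st B τ k + j + 1) = B j := by
  have hle := st_le (B := B) (τ := τ) k
  have h1 := st_sub_add (B := B) (τ := τ) k j hj.le
  have h2 := st_sub_add (B := B) (τ := τ) k (j + 1) hj
  have h3 := hτ (k - st B τ k + j) (by omega)
  rw [h1] at h3
  refine le_antisymm h3 ?_
  by_contra! hlt
  rw [← add_assoc, st_succ_of_lt (by rwa [h1])] at h2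
  omega

/-- Blocks of the parse do not straddle an earlier block end: inside the block that contains `m'`
the state is positive from its first digit on. -/
theorem lt_sub_st {m m' : ℕ} (h : st B τ m = 0) (hm : 1 ≤ m) (hlt : m < m') :
    m < m' - st B τ (m' - 1) := by
  by_contra! hge
  have hle := st_le (B := B) (τ := τ) (m' - 1)
  have := st_sub_add (B := B) (τ := τ) (m' - 1) (m - (m' - 1 - st B τ (m' - 1))) (by omega)
  rw [show m' - 1 - st B τ (m' - 1) + (m - (m' - 1 - st B τ (m' - 1))) = m by omega] at this
  omega

theorem st_eq_zero_of_zeros (hB : 0 < B 0) {p : ℕ} (h : ∀ j, 1 ≤ j → j ≤ p → τ j = 0) :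
    ∀ k ≤ p, st B τ k = 0 := by
  intro k hk
  induction k with
  | zero => rfl
  | succ k ih =>
    refine st_succ_of_lt ?_
    rw [ih (by omega), h (k + 1) (by omega) hk]
    exact hB

theorem st_add_of_forall_ne_zero {n : ℕ} (h : ∀ k, n < k → st B τ k ≠ 0) (j : ℕ) :
    st B τ (n + j) = st B τ n + j := by
  induction j with
  | zero => rfl
  | succ j ih =>
    have h1 := h (n + j + 1) (by omega)
    have h2 := st_succ_of_ge (not_lt.mp fun hlt => h1 (st_succ_of_lt hlt))
    rw [← add_assoc, h2, ih, add_assoc]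

/-- Trailing zeros cannot copy `B` forever, since `B` has positive entries arbitrarily far out; a
zero read against such an entry completes the block. -/
theorem exists_st_eq_zero_of_zeros (hB' : ∀ s, ∃ j ≥ s, 0 < B j) {n : ℕ}
    (h : ∀ k, n < k → τ k = 0) (n' : ℕ) : ∃ k, n' < k ∧ st B τ k = 0 := by
  by_contra! hno
  have hst := st_add_of_forall_ne_zero fun k (hk : max n n' < k) => hno k (by omega)
  obtain ⟨j, hj, hpos⟩ := hB' (st B τ (max n n'))
  have h1 := hst (j - st B τ (max n n'))
  rw [Nat.add_sub_cancel' hj] at h1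
  refine hno (max n n' + (j - st B τ (max n n')) + 1) (by omega) (st_succ_of_lt ?_)
  rw [h1, h _ (by omega)]
  exact hpos

/-! ### Families of blocks and parsing -/

section Family

variable {I : Set ℕ} {i b : ℕ → ℕ} {P : ℕ}

/-- Within a block the state is the offset from its start. An index outside all blocks carries the
digit 0, which is a complete one-digit block because `0 < B 0`. The cutoff `P` exempts a block
ending at `P` from having a smaller last digit, as is needed for reversed maximal `L`-blocks. -/
theorem st_of_family (hB : 0 < B 0) (h1 : ∀ m ∈ I, 1 ≤ i m ∧ i m ≤ b m)
    (h2 : I.Pairwise fun m m' => Disjoint (Set.Icc (i m) (b m)) (Set.Icc (i m') (b m')))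
    (h3 : ∀ m ∈ I, ∀ k, i m ≤ k → k < b m → τ k = B (k - i m))
    (h4 : ∀ m ∈ I, b m < P → τ (b m) < B (b m - i m))
    (h5 : ∀ k, 1 ≤ k → k ≤ P → (∀ m ∈ I, ¬ (i m ≤ k ∧ k ≤ b m)) → τ k = 0) :
    ∀ k < P, (∀ m ∈ I, i m ≤ k → k + 1 ≤ b m → st B τ k = k + 1 - i m) ∧
      ((∀ m ∈ I, ¬ (i m ≤ k ∧ k + 1 ≤ b m)) → st B τ k = 0) := by
  have huniq : ∀ m ∈ I, ∀ m' ∈ I, ∀ k, i m ≤ k → k ≤ b m → i m' ≤ k → k ≤ b m' → m = m' := by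
    intro m hm m' hm' k a1 a2 a3 a4
    by_contra hne
    exact Set.disjoint_left.mp (h2 hm hm' hne) ⟨a1, a2⟩ ⟨a3, a4⟩
  intro k hk
  induction k with
  | zero =>
    refine ⟨fun m hm h _ => ?_, fun _ => rfl⟩
    have := (h1 m hm).1
    omega
  | succ k ih =>
    obtain ⟨ih1, ih2⟩ := ih (by omega)
    by_cases hex : ∃ m ∈ I, i m ≤ k + 1 ∧ k + 1 ≤ b m
    · obtain ⟨m, hm, hi, hb⟩ := hex
      have hst : st B τ k = k + 1 - i m := by
        rcases Nat.lt_or_ge k (i m) with hlt | hge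
        · rw [ih2, show k + 1 - i m = 0 by omega]
          rintro m' hm' ⟨hi', hb'⟩
          have := huniq m hm m' hm' (k + 1) hi hb (by omega) hb'
          subst this
          omega
        · exact ih1 m hm hge hb
      rcases Nat.lt_or_ge (k + 1) (b m) with hlt | hge
      · have hs : st B τ (k + 1) = k + 1 + 1 - i m := by
          rw [st_succ_of_ge, hst]
          · omega
          · rw [h3 m hm (k + 1) hi hlt, hst]
        refine ⟨fun m' hm' hi' hb' => ?_, fun hno => absurd ⟨hi, hlt⟩ (hno m hm)⟩
        rw [huniq m' hm' m hm (k + 1) hi' (by omega) hi hb, hs]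
      · have hbm : b m = k + 1 := by omega
        have h4m := h4 m hm (by omega)
        rw [hbm] at h4m
        refine ⟨fun m' hm' hi' hb' => ?_, fun _ => st_succ_of_lt (by rwa [hst])⟩
        have := huniq m' hm' m hm (k + 1) hi' (by omega) hi hb
        subst this
        omega
    · push Not at hex
      have h0 : st B τ k = 0 := by
        refine ih2 fun m hm hh => ?_
        have := hex m hm (by omega)
        omega
      refine ⟨fun m hm hi hb => ?_, fun _ => st_succ_of_lt ?_⟩
      · have := hex m hm hi
        omega
      · rw [h0, h5 (k + 1) (by omega) (by omega) fun m hm hh => by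
          have := hex m hm hh.1
          omega]
        exact hB

theorem isAcceptedUpTo_of_family (hB : 0 < B 0) (h1 : ∀ m ∈ I, 1 ≤ i m ∧ i m ≤ b m)
    (h2 : I.Pairwise fun m m' => Disjoint (Set.Icc (i m) (b m)) (Set.Icc (i m') (b m')))
    (h3 : ∀ m ∈ I, ∀ k, i m ≤ k → k < b m → τ k = B (k - i m))
    (h4 : ∀ m ∈ I, b m < P → τ (b m) < B (b m - i m))
    (h4' : ∀ m ∈ I, b m = P → τ (b m) ≤ B (b m - i m))
    (h5 : ∀ k, 1 ≤ k → k ≤ P → (∀ m ∈ I, ¬ (i m ≤ k ∧ k ≤ b m)) → τ k = 0) :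
    IsAcceptedUpTo B τ P ∧ ∀ m ∈ I, b m < P → st B τ (b m) = 0 := by
  have key := st_of_family hB h1 h2 h3 h4 h5
  refine ⟨fun k hk => ?_, fun m hm hb => (key (b m) hb).2 fun m' hm' hh => ?_⟩
  · by_cases hex : ∃ m ∈ I, i m ≤ k + 1 ∧ k + 1 ≤ b m
    · obtain ⟨m, hm, hi, hb⟩ := hex
      have hst : st B τ k = k + 1 - i m := by
        rcases Nat.lt_or_ge k (i m) with hlt | hge
        · rw [(key k hk).2, show k + 1 - i m = 0 by omega]
          rintro m' hm' ⟨hi', hb'⟩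
          have hne : m ≠ m' := by
            rintro rfl
            omega
          exact Set.disjoint_left.mp (h2 hm hm' hne) ⟨hi, hb⟩ ⟨by omega, hb'⟩
        · exact (key k hk).1 m hm hge hb
      rw [hst]
      rcases Nat.lt_or_ge (k + 1) (b m) with hlt | hge
      · exact (h3 m hm (k + 1) hi hlt).le
      · have hbm : b m = k + 1 := by omega
        rcases Nat.lt_or_ge (b m) P with hP | hP
        · have := h4 m hm hP
          rw [hbm] at this
          exact this.le
        · have := h4' m hm (by omega)
          rwa [hbm] at this
    · push Not at hex
      rw [h5 (k + 1) (by omega) (by omega) fun m hm hh => by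
          have := hex m hm hh.1
          omega]
      exact Nat.zero_le _
  · have hne : m ≠ m' := by
      rintro rfl
      omega
    exact Set.disjoint_left.mp (h2 hm hm' hne) ⟨(h1 m hm).2, le_rfl⟩
      ⟨hh.1, by omega⟩

theorem finsum_mem_eq_of_forall_ne {f : ℕ → ℕ} {m : ℕ} (hm : m ∈ I)
    (h : ∀ m' ∈ I, m' ≠ m → f m' = 0) : ∑ᶠ m' ∈ I, f m' = f m := by
  rw [finsum_eq_single _ m]
  · simp [hm]
  · intro m' hne
    by_cases hm' : m' ∈ I
    · simp [hm', h m' hm' hne]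
    · simp [hm']

theorem finsum_mem_eq_zero_of_forall {f : ℕ → ℕ} (h : ∀ m ∈ I, f m = 0) :
    ∑ᶠ m ∈ I, f m = 0 := by
  rw [finsum_mem_congr rfl h, finsum_mem_zero]

theorem family_sum {ζ : ℕ → ℕ → ℕ}
    (h2 : I.Pairwise fun m m' => Disjoint (Set.Icc (i m) (b m)) (Set.Icc (i m') (b m')))
    (hζ : ∀ m ∈ I, ∀ k, ¬ (i m ≤ k ∧ k ≤ b m) → ζ m k = 0)
    (hτ : ∀ k, τ k = ∑ᶠ m ∈ I, ζ m k) :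
    (∀ m ∈ I, ∀ k, i m ≤ k → k ≤ b m → τ k = ζ m k) ∧
      ∀ k, (∀ m ∈ I, ¬ (i m ≤ k ∧ k ≤ b m)) → τ k = 0 := by
  refine ⟨fun m hm k hi hb => ?_, fun k hk => ?_⟩
  · rw [hτ, finsum_mem_eq_of_forall_ne hm]
    intro m' hm' hne
    exact hζ m' hm' k fun hh => Set.disjoint_left.mp (h2 hm' hm hne) hh ⟨hi, hb⟩
  · rw [hτ, finsum_mem_eq_zero_of_forall]
    exact fun m hm => hζ m hm k (hk m hm)

/-- The part of `τ` in the block that contains index `m`, up to `m`. -/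
def blockPart (B τ : ℕ → ℕ) (m : ℕ) : ℕ → ℕ :=
  fun k => if m - st B τ (m - 1) ≤ k ∧ k ≤ m then τ k else 0

/-- The hypothesis on `I` makes all its elements block ends except possibly the largest, so that an
unfinished last block can be included. -/
theorem pairwise_disjoint_blockPart (h1 : ∀ m ∈ I, 1 ≤ m)
    (h : ∀ m ∈ I, ∀ j, 1 ≤ j → j < m → (j ∈ I ↔ st B τ j = 0)) :
    I.Pairwise fun m m' => Disjoint (Set.Icc (m - st B τ (m - 1)) m)
      (Set.Icc (m' - st B τ (m' - 1)) m') := by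
  intro m hm m' hm' hne
  rw [Set.disjoint_left]
  rintro x ⟨a1, a2⟩ ⟨a3, a4⟩
  rcases Nat.lt_or_ge m m' with hlt | hge
  · have := lt_sub_st ((h m' hm' m (h1 m hm) hlt).mp hm) (h1 m hm) hlt
    omega
  · have hlt : m' < m := by omega
    have := lt_sub_st ((h m hm m' (h1 m' hm') hlt).mp hm') (h1 m' hm') hlt
    omega

theorem finsum_blockPart (h1 : ∀ m ∈ I, 1 ≤ m)
    (h : ∀ m ∈ I, ∀ j, 1 ≤ j → j < m → (j ∈ I ↔ st B τ j = 0)) {k : ℕ} (hk : 1 ≤ k)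
    (hex : ∃ m ∈ I, k ≤ m) : ∑ᶠ m ∈ I, blockPart B τ m k = τ k := by
  classical
  obtain ⟨hm, hkm⟩ := Nat.find_spec hex
  have hmin := fun j => Nat.find_min (H := hex) (m := j)
  set m := Nat.find hex
  -- Otherwise the block end just before the block of `m` is an element of `I` in `[k, m)`, against
  -- the minimality of `m`.
  have hlow : m - st B τ (m - 1) ≤ k := by
    by_contra! hlt
    have hle := st_le (B := B) (τ := τ) (m - 1)
    have h0 := st_sub_add (B := B) (τ := τ) (m - 1) 0 (Nat.zero_le _)
    refine hmin (m - 1 - st B τ (m - 1)) (by omega) ⟨?_, by omega⟩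
    exact (h m hm _ (by omega) (by omega)).mpr h0
  rw [finsum_mem_eq_of_forall_ne hm]
  · simp [blockPart, hlow, hkm]
  · intro m' hm' hne
    have hd := pairwise_disjoint_blockPart h1 h hm' hm hne
    exact if_neg fun hh => Set.disjoint_left.mp hd hh ⟨hlow, hkm⟩

theorem finsum_blockPart_eq_zero {k : ℕ} (hk : ∀ m ∈ I, m < k) :
    ∑ᶠ m ∈ I, blockPart B τ m k = 0 := by
  refine finsum_mem_eq_zero_of_forall fun m hm => if_neg fun hh => ?_
  have := hk m hm
  omega

end Family

/-! ### The collections in terms of parsing -/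

variable {N M : ℕ} {e e' : ℕ → ℕ}

theorem maxBlock_apply (n k : ℕ) :
    maxBlock N e n k = if n ≤ k then dig N e (k - n) else 0 := rfl

theorem IsProperStarBlock.eq_zero {n k j : ℕ} {ζ : ℕ → ℕ} (h : IsProperStarBlock N e n k ζ)
    (hj : ¬ (n ≤ j ∧ j ≤ k)) : ζ j = 0 := by
  obtain ⟨h1, h2, h3, h4, h5⟩ := h
  rcases Nat.lt_or_ge k j with hlt | hge
  · exact h5 j hlt
  · rw [h3 j (by omega), maxBlock_apply, if_neg (by omega)]

theorem isAccepted_of_starFamily {I : Set ℕ} {ζ : ℕ → ℕ → ℕ} {i b : ℕ → ℕ}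
    (hB : 0 < dig N e 0) (hf : IsDisjointFamily (IsProperStarBlock N e) I ζ i b)
    (hτ : ∀ k, τ k = ∑ᶠ m ∈ I, ζ m k) :
    IsAccepted (dig N e) τ ∧ ∀ m ∈ I, st (dig N e) τ (b m) = 0 := by
  obtain ⟨hs, h0⟩ := family_sum hf.2 (fun m hm k hk => (hf.1 m hm).eq_zero hk) hτ
  have key := fun P => isAcceptedUpTo_of_family (B := dig N e) (τ := τ) (P := P) hB
    (fun m hm => ⟨(hf.1 m hm).1, (hf.1 m hm).2.1⟩) hf.2
    (fun m hm k hi hb => by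
      rw [hs m hm k hi hb.le, (hf.1 m hm).2.2.1 k hb, maxBlock_apply, if_pos hi])
    (fun m hm _ => by
      have := (hf.1 m hm).2.2.2.1
      rwa [maxBlock_apply, if_pos (hf.1 m hm).2.1,
        ← hs m hm _ (hf.1 m hm).2.1 le_rfl] at this)
    (fun m hm _ => by
      have := (hf.1 m hm).2.2.2.1
      rw [maxBlock_apply, if_pos (hf.1 m hm).2.1,
        ← hs m hm _ (hf.1 m hm).2.1 le_rfl] at this
      exact this.le)
    (fun k _ _ hk => h0 k hk)
  refine ⟨⟨h0 0 fun m hm hh => ?_, fun k => (key (k + 1)).1 k (by omega)⟩,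
    fun m hm => (key (b m + 1)).2 m hm (by omega)⟩
  have := (hf.1 m hm).1
  omega

theorem isProperStarBlock_blockPart {m : ℕ} (hm : 1 ≤ m) (h0 : st (dig N e) τ m = 0)
    (hτ : IsAcceptedUpTo (dig N e) τ m) :
    IsProperStarBlock N e (m - st (dig N e) τ (m - 1)) m (blockPart (dig N e) τ m) := by
  obtain ⟨k, rfl⟩ : ∃ k, m = k + 1 := ⟨m - 1, by omega⟩
  have hle := st_le (B := dig N e) (τ := τ) k
  have hbp : ∀ j, blockPart (dig N e) τ (k + 1) j =
      if k + 1 - st (dig N e) τ k ≤ j ∧ j ≤ k + 1 then τ j else 0 := fun j => rfl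
  rw [Nat.add_sub_cancel]
  refine ⟨by omega, by omega, fun j hj => ?_, ?_, fun j hj => if_neg (by omega)⟩
  · rw [maxBlock_apply, hbp]
    by_cases h : k + 1 - st (dig N e) τ k ≤ j
    · rw [if_pos ⟨h, hj.le⟩, if_pos h]
      have hτ' : IsAcceptedUpTo (dig N e) τ k := fun l hl => hτ l (by omega)
      have := hτ'.eq_of_lt_st (j := j - (k + 1 - st (dig N e) τ k)) (by omega)
      rwa [show k - st (dig N e) τ k + (j - (k + 1 - st (dig N e) τ k)) + 1 = j by omega] at this
    · rw [if_neg (by omega), if_neg h]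
  · rw [maxBlock_apply, hbp, if_pos ⟨by omega, le_rfl⟩, if_pos (by omega),
      show k + 1 - (k + 1 - st (dig N e) τ k) = st (dig N e) τ k by omega]
    exact st_succ_eq_zero_iff.mp h0

theorem IsAccepted.upTo (h : IsAccepted B τ) (p : ℕ) : IsAcceptedUpTo B τ p := fun k _ => h.2 k

theorem mem_blockSums_iff (hB : 0 < dig N e 0) {n : ℕ} {ε : ℕ → ℕ} :
    ε ∈ blockSums N e n ↔
      IsAccepted (dig N e) ε ∧ st (dig N e) ε n = 0 ∧ ∀ k, n < k → ε k = 0 := by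
  constructor
  · rintro (⟨rfl, rfl⟩ | ⟨I, ζ, i, b, hf, hle, ⟨m, hm, hmn⟩, rfl⟩)
    · exact ⟨⟨rfl, fun k => Nat.zero_le _⟩, rfl, fun k _ => rfl⟩
    · have hτ : ∀ k, (∑ m ∈ I, ζ m) k = ∑ᶠ m ∈ (I : Set ℕ), ζ m k := fun k => by
        rw [finsum_mem_coe_finset, Finset.sum_apply]
      obtain ⟨h1, h2⟩ := isAccepted_of_starFamily hB hf hτ
      refine ⟨h1, hmn ▸ h2 m hm, fun k hk => ?_⟩
      rw [Finset.sum_apply]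
      refine Finset.sum_eq_zero fun m hm => (hf.1 m hm).eq_zero fun hh => ?_
      have := hle m hm
      omega
  · rintro ⟨h1, h2, h3⟩
    rcases Nat.eq_zero_or_pos n with rfl | hn
    · refine Or.inl ⟨rfl, funext fun k => ?_⟩
      rcases Nat.eq_zero_or_pos k with rfl | hk
      · exact h1.1
      · exact h3 k hk
    · refine Or.inr ⟨(Finset.Icc 1 n).filter fun m => st (dig N e) ε m = 0,
        blockPart (dig N e) ε, fun m => m - st (dig N e) ε (m - 1), id, ⟨?_, ?_⟩, ?_, ?_, ?_⟩
      · intro m hm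
        simp only [Finset.coe_filter, Finset.mem_Icc, Set.mem_ofPred_eq] at hm
        exact isProperStarBlock_blockPart hm.1.1 hm.2 (h1.upTo m)
      · refine pairwise_disjoint_blockPart ?_ ?_
        · intro m hm
          simp only [Finset.coe_filter, Finset.mem_Icc, Set.mem_ofPred_eq] at hm
          exact hm.1.1
        · intro m hm j hj hjm
          simp only [Finset.coe_filter, Finset.mem_Icc, Set.mem_ofPred_eq] at hm ⊢
          exact ⟨fun h => h.2, fun h => ⟨⟨hj, by omega⟩, h⟩⟩
      · intro m hm
        simp only [Finset.mem_filter, Finset.mem_Icc] at hm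
        exact hm.1.2
      · exact ⟨n, by simp [h2]; omega, rfl⟩
      · funext k
        rw [Finset.sum_apply, ← finsum_mem_coe_finset]
        rcases Nat.eq_zero_or_pos k with rfl | hk
        · rw [finsum_mem_eq_zero_of_forall, h1.1]
          intro m _
          simp [blockPart, h1.1]
        · rcases Nat.lt_or_ge n k with hlt | hge
          · rw [finsum_blockPart_eq_zero, h3 k hlt]
            intro m hm
            simp only [Finset.coe_filter, Finset.mem_Icc, Set.mem_ofPred_eq] at hm
            omega
          · refine (finsum_blockPart ?_ ?_ hk ⟨n, by simp [h2]; omega, hge⟩).symm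
            · intro m hm
              simp only [Finset.coe_filter, Finset.mem_Icc, Set.mem_ofPred_eq] at hm
              exact hm.1.1
            · intro m hm j hj hjm
              simp only [Finset.coe_filter, Finset.mem_Icc, Set.mem_ofPred_eq] at hm ⊢
              exact ⟨fun h => h.2, fun h => ⟨⟨hj, by omega⟩, h⟩⟩

/-- Infinitely many block ends are required even of finite sums, because the zeros after the last
block split into proper blocks themselves. -/
theorem mem_starColl_iff (hB : 0 < dig N e 0) (hB' : ∀ s, ∃ j ≥ s, 0 < dig N e j) {ε : ℕ → ℕ} :
    ε ∈ starColl N e ↔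
      ε ≠ 0 ∧ IsAccepted (dig N e) ε ∧ ∀ n, ∃ k, n < k ∧ st (dig N e) ε k = 0 := by
  constructor
  · rintro ⟨hne, I, ζ, i, b, hf, hτ⟩
    obtain ⟨h1, h2⟩ := isAccepted_of_starFamily hB hf hτ
    refine ⟨hne, h1, fun n => ?_⟩
    by_contra! hno
    have hz : ∀ k, n < k → ε k = 0 := fun k hk => by
      rw [hτ, finsum_mem_eq_zero_of_forall]
      refine fun m hm => (hf.1 m hm).eq_zero fun hh => ?_
      exact hno (b m) (by omega) (h2 m hm)
    obtain ⟨k, hk, h0⟩ := exists_st_eq_zero_of_zeros hB' hz n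
    exact hno k hk h0
  · rintro ⟨hne, h1, h2⟩
    have hI : ∀ m ∈ {m | 1 ≤ m ∧ st (dig N e) ε m = 0}, ∀ j, 1 ≤ j → j < m →
        (j ∈ {m | 1 ≤ m ∧ st (dig N e) ε m = 0} ↔ st (dig N e) ε j = 0) :=
      fun m _ j hj _ => ⟨fun h => h.2, fun h => ⟨hj, h⟩⟩
    refine ⟨hne, {m | 1 ≤ m ∧ st (dig N e) ε m = 0}, blockPart (dig N e) ε,
      fun m => m - st (dig N e) ε (m - 1), id, ⟨?_, ?_⟩, fun k => ?_⟩
    · exact fun m hm => isProperStarBlock_blockPart hm.1 hm.2 (h1.upTo m)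
    · exact pairwise_disjoint_blockPart (fun m hm => hm.1) hI
    · rcases Nat.eq_zero_or_pos k with rfl | hk
      · rw [finsum_mem_eq_zero_of_forall, h1.1]
        intro m _
        simp [blockPart, h1.1]
      · obtain ⟨m, hm, h0⟩ := h2 k
        exact (finsum_blockPart (fun m hm => hm.1) hI hk ⟨m, ⟨by omega, h0⟩, hm.le⟩).symm

theorem rev_apply (n k : ℕ) (ε : ℕ → ℕ) :
    rev n ε k = if 1 ≤ k ∧ k ≤ n then ε (n + 1 - k) else 0 := rfl

/-- A common description of proper and maximal blocks: the digit at the lower end may fail to be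
smaller only if the block reaches index 1. -/
theorem IsBlock.cases {k p : ℕ} {ζ : ℕ → ℕ} (h : IsBlock N e k p ζ) :
    1 ≤ k ∧ k ≤ p ∧ (∀ j, k < j → j ≤ p → ζ j = dig N e (p - j)) ∧
      (1 < k → ζ k < dig N e (p - k)) ∧ ζ k ≤ dig N e (p - k) ∧
      ∀ j, ¬ (k ≤ j ∧ j ≤ p) → ζ j = 0 := by
  have hr : ∀ j, 1 ≤ j → j ≤ p → rev p (maxBlock N e 1) j = dig N e (p - j) := by
    intro j h1 h2
    rw [rev_apply, if_pos ⟨h1, h2⟩, maxBlock_apply, if_pos (by omega)]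
    congr 1
    omega
  have hr' : ∀ j, p < j → rev p (maxBlock N e 1) j = 0 := by
    intro j h1
    rw [rev_apply, if_neg (by omega)]
  rcases h with ⟨h1, h2, h3, h4, h5⟩ | ⟨rfl, h2, rfl⟩
  · rw [hr k h1 h2] at h4
    refine ⟨h1, h2, fun j hj hjp => ?_, fun _ => h4, h4.le, fun j hj => ?_⟩
    · rw [h3 j hj, hr j (by omega) hjp]
    · rcases Nat.lt_or_ge j k with hlt | hge
      · exact h5 j hlt
      · rw [h3 j (by omega), hr' j (by omega)]
  · refine ⟨le_rfl, h2, fun j hj hjp => hr j hj.le hjp, fun h => absurd h (lt_irrefl 1),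
      (hr 1 le_rfl h2).le, fun j hj => ?_⟩
    rw [rev_apply, if_neg (by omega)]

/-- Reversal turns a completed piece of the parse into a proper block; an unfinished piece is
possible only at the end of the word, where it becomes a maximal block. -/
theorem isBlock_rev_blockPart {m p : ℕ} (hm : 1 ≤ m) (hmp : m ≤ p)
    (h0 : st (dig N e) τ m = 0 ∨ m = p) (hτ : IsAcceptedUpTo (dig N e) τ m) :
    IsBlock N e (p + 1 - m) (p + 1 - (m - st (dig N e) τ (m - 1)))
      (rev p (blockPart (dig N e) τ m)) := by
  obtain ⟨k, rfl⟩ : ∃ k, m = k + 1 := ⟨m - 1, by omega⟩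
  have hle := st_le (B := dig N e) (τ := τ) k
  have hbp : ∀ j, blockPart (dig N e) τ (k + 1) j =
      if k + 1 - st (dig N e) τ k ≤ j ∧ j ≤ k + 1 then τ j else 0 := fun j => rfl
  have hτ' : IsAcceptedUpTo (dig N e) τ k := fun l hl => hτ l (by omega)
  rw [Nat.add_sub_cancel]
  have hhigh : ∀ j, p + 1 - (k + 1) < j → rev p (blockPart (dig N e) τ (k + 1)) j =
      rev (p + 1 - (k + 1 - st (dig N e) τ k)) (maxBlock N e 1) j := by
    intro j hj
    rw [rev_apply, rev_apply]
    by_cases h : j ≤ p + 1 - (k + 1 - st (dig N e) τ k)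
    · rw [if_pos (by omega), if_pos (by omega), hbp, if_pos (by omega), maxBlock_apply,
        if_pos (by omega)]
      have := hτ'.eq_of_lt_st (j := p + 1 - j - (k + 1 - st (dig N e) τ k)) (by omega)
      rw [show k - st (dig N e) τ k + (p + 1 - j - (k + 1 - st (dig N e) τ k)) + 1 = p + 1 - j
        by omega] at this
      rw [this]
      congr 1
      omega
    · rw [if_neg (c := 1 ≤ j ∧ j ≤ p + 1 - (k + 1 - st (dig N e) τ k)) (by omega), hbp]
      split_ifs <;> first | rfl | omega
  have hlow : ∀ j, j < p + 1 - (k + 1) → rev p (blockPart (dig N e) τ (k + 1)) j = 0 := by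
    intro j hj
    rw [rev_apply, hbp]
    split_ifs <;> first | rfl | omega
  have hat : rev p (blockPart (dig N e) τ (k + 1)) (p + 1 - (k + 1)) = τ (k + 1) := by
    rw [rev_apply, if_pos (by omega), hbp, show p + 1 - (p + 1 - (k + 1)) = k + 1 by omega,
      if_pos (by omega)]
  have hat' : rev (p + 1 - (k + 1 - st (dig N e) τ k)) (maxBlock N e 1) (p + 1 - (k + 1)) =
      dig N e (st (dig N e) τ k) := by
    rw [rev_apply, if_pos (by omega), maxBlock_apply, if_pos (by omega)]
    congr 1
    omega
  by_cases hz : τ (k + 1) < dig N e (st (dig N e) τ k)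
  · exact Or.inl ⟨by omega, by omega, hhigh, by rwa [hat, hat'], hlow⟩
  · have hkp : k + 1 = p := h0.resolve_left fun h => hz (st_succ_eq_zero_iff.mp h)
    refine Or.inr ⟨by omega, by omega, funext fun j => ?_⟩
    rcases lt_trichotomy j (p + 1 - (k + 1)) with h | rfl | h
    · rw [hlow j h, rev_apply, if_neg (by omega)]
    · rw [hat, hat']
      exact le_antisymm (hτ k (by omega)) (not_lt.mp hz)
    · exact hhigh j h

theorem rev_mem_coll {p : ℕ} (hτ : IsAcceptedUpTo (dig N e) τ p) : rev p τ ∈ coll N e := by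
  have hmem : ∀ {m}, m ∈ (((Finset.Icc 1 p).filter fun m => st (dig N e) τ m = 0 ∨ m = p :
      Finset ℕ) : Set ℕ) ↔ (1 ≤ m ∧ m ≤ p) ∧ (st (dig N e) τ m = 0 ∨ m = p) := by
    intro m
    simp
  have h1 : ∀ m ∈ (((Finset.Icc 1 p).filter fun m => st (dig N e) τ m = 0 ∨ m = p :
      Finset ℕ) : Set ℕ), 1 ≤ m := fun m hm => (hmem.mp hm).1.1
  have h : ∀ m ∈ (((Finset.Icc 1 p).filter fun m => st (dig N e) τ m = 0 ∨ m = p :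
      Finset ℕ) : Set ℕ), ∀ j, 1 ≤ j → j < m →
      (j ∈ (((Finset.Icc 1 p).filter fun m => st (dig N e) τ m = 0 ∨ m = p :
      Finset ℕ) : Set ℕ) ↔ st (dig N e) τ j = 0) := by
    intro m hm j hj hjm
    have := (hmem.mp hm).1.2
    rw [hmem]
    exact ⟨fun h => h.2.resolve_right (by omega), fun h => ⟨⟨hj, by omega⟩, Or.inl h⟩⟩
  refine ⟨(Finset.Icc 1 p).filter fun m => st (dig N e) τ m = 0 ∨ m = p,
    fun m => rev p (blockPart (dig N e) τ m), fun m => p + 1 - m,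
    fun m => p + 1 - (m - st (dig N e) τ (m - 1)), ⟨fun m hm => ?_, fun m hm m' hm' hne => ?_⟩,
    funext fun k => ?_⟩
  · obtain ⟨hm1, hm2⟩ := hmem.mp hm
    exact isBlock_rev_blockPart hm1.1 hm1.2 hm2 fun l hl => hτ l (by omega)
  · have hd := pairwise_disjoint_blockPart h1 h hm hm' hne
    have hm1 := (hmem.mp hm).1
    have hm1' := (hmem.mp hm').1
    have hle := st_le (B := dig N e) (τ := τ) (m - 1)
    have hle' := st_le (B := dig N e) (τ := τ) (m' - 1)
    beta_reduce at hd ⊢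
    rw [Set.disjoint_left] at hd ⊢
    rintro x ⟨a1, a2⟩ ⟨a3, a4⟩
    exact hd (a := p + 1 - x) ⟨by omega, by omega⟩ ⟨by omega, by omega⟩
  · rw [Finset.sum_apply]
    simp only [rev_apply]
    split_ifs with hk
    · rw [← finsum_mem_coe_finset, finsum_blockPart h1 h (by omega) ⟨p, ?_, by omega⟩]
      exact hmem.mpr ⟨⟨by omega, le_rfl⟩, Or.inr rfl⟩
    · simp

theorem isAcceptedUpTo_of_rev_mem_coll (hB : 0 < dig N e 0) {p : ℕ}
    (h : rev p τ ∈ coll N e) : IsAcceptedUpTo (dig N e) τ p := by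
  obtain ⟨I, ζ, i, b, hf, hsum⟩ := h
  have hτ : ∀ k, rev p τ k = ∑ᶠ m ∈ (I : Set ℕ), ζ m k := fun k => by
    rw [finsum_mem_coe_finset, hsum, Finset.sum_apply]
  obtain ⟨hs, h0⟩ := family_sum hf.2 (fun m hm k hk => (hf.1 m hm).cases.2.2.2.2.2 k hk) hτ
  -- Blocks of zeros may be supported above `p`, so the reversal is taken at a common bound `P`.
  -- This puts `P - p` zeros in front, which leave the parser in state 0 and are then shifted away.
  obtain ⟨P, hpP, hP⟩ : ∃ P, p ≤ P ∧ ∀ m ∈ I, b m ≤ P :=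
    ⟨p + I.sup b, by omega, fun m hm => by have := Finset.le_sup (f := b) hm; omega⟩
  have hrev : ∀ k, 1 ≤ k → k ≤ P → rev P (rev p τ) k = rev p τ (P + 1 - k) :=
    fun k h1 h2 => by rw [rev_apply, if_pos ⟨h1, h2⟩]
  have hacc : IsAcceptedUpTo (dig N e) (rev P (rev p τ)) P := by
    refine (isAcceptedUpTo_of_family (I := (I : Set ℕ)) (i := fun m => P + 1 - b m)
      (b := fun m => P + 1 - i m) hB ?_ ?_ ?_ ?_ ?_ ?_).1
    · intro m hm
      obtain ⟨c1, c2, -⟩ := (hf.1 m hm).cases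
      have := hP m hm
      omega
    · intro m hm m' hm' hne
      have hd := hf.2 hm hm' hne
      obtain ⟨c1, c2, -⟩ := (hf.1 m hm).cases
      obtain ⟨c1', c2', -⟩ := (hf.1 m' hm').cases
      have := hP m hm
      have := hP m' hm'
      beta_reduce at hd ⊢
      rw [Set.disjoint_left] at hd ⊢
      rintro x ⟨a1, a2⟩ ⟨a3, a4⟩
      exact hd (a := P + 1 - x) ⟨by omega, by omega⟩ ⟨by omega, by omega⟩
    · intro m hm k hi hb
      obtain ⟨c1, c2, c3, -⟩ := (hf.1 m hm).cases
      have := hP m hm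
      rw [hrev k (by omega) (by omega), hs m hm _ (by omega) (by omega),
        c3 _ (by omega) (by omega)]
      congr 1
      omega
    · intro m hm hb
      obtain ⟨c1, c2, c3, c4, -⟩ := (hf.1 m hm).cases
      have := hP m hm
      rw [hrev _ (by omega) (by omega), show P + 1 - (P + 1 - i m) = i m by omega,
        hs m hm _ le_rfl c2, show P + 1 - i m - (P + 1 - b m) = b m - i m by omega]
      exact c4 (by omega)
    · intro m hm hb
      obtain ⟨c1, c2, c3, c4, c5, -⟩ := (hf.1 m hm).cases
      have := hP m hm
      rw [hrev _ (by omega) (by omega), show P + 1 - (P + 1 - i m) = i m by omega,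
        hs m hm _ le_rfl c2, show P + 1 - i m - (P + 1 - b m) = b m - i m by omega]
      exact c5
    · intro k h1 h2 hk
      rw [hrev k h1 h2]
      refine h0 _ fun m hm hh => hk m hm ?_
      obtain ⟨c1, c2, -⟩ := (hf.1 m hm).cases
      have := hP m hm
      omega
  have hz : st (dig N e) (rev P (rev p τ)) (P - p) = 0 := by
    refine st_eq_zero_of_zeros hB (p := P - p) (fun j h1 h2 => ?_) _ le_rfl
    rw [hrev j h1 (by omega), rev_apply, if_neg (by omega)]
  have hshift : IsAcceptedUpTo (dig N e) (fun j => rev P (rev p τ) (P - p + j)) p := by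
    intro k hk
    rw [← st_add hz]
    exact hacc (P - p + k) (by omega)
  refine hshift.congr fun j h1 h2 => ?_
  rw [hrev _ (by omega) (by omega), rev_apply, if_pos (by omega)]
  congr 1
  omega

theorem IsAcceptedUpTo.of_coll_subset (hB : 0 < dig M e' 0) (h : coll N e ⊆ coll M e') {p : ℕ}
    (hτ : IsAcceptedUpTo (dig N e) τ p) : IsAcceptedUpTo (dig M e') τ p :=
  isAcceptedUpTo_of_rev_mem_coll hB (h (rev_mem_coll hτ))

/-- Different lists may have the same periodic continuation; strict inclusion excludes this. -/
theorem coll_eq_of_maxBlock_eq (h : maxBlock N e 1 = maxBlock M e' 1) :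
    coll N e = coll M e' := by
  have : IsBlock N e = IsBlock M e' := by
    funext k p ζ
    simp only [IsBlock, IsProperBlock, IsMaximalBlock, h]
  simp only [coll, this]

end Zeck

namespace Zeck

/-! ### Values of digit sequences -/

/-- The value of the digits after index `k`, scaled to start with the exponent `1`. -/
noncomputable def tailVal (x : ℝ) (τ : ℕ → ℕ) (k : ℕ) : ℝ := ∑' j, (τ (k + 1 + j) : ℝ) * x ^ (j + 1)

section Values

variable {τ σ : ℕ → ℕ} {x ω : ℝ} {K : ℕ}

theorem summable_mul_pow (hx : |x| < 1) (hK : ∀ j, τ j ≤ K) :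
    Summable fun j => (τ j : ℝ) * x ^ j := by
  refine Summable.of_norm_bounded (g := fun j => (K : ℝ) * |x| ^ j)
    ((summable_geometric_of_lt_one (abs_nonneg x) hx).mul_left _) fun j => ?_
  rw [norm_mul, norm_pow, Real.norm_eq_abs, Real.norm_eq_abs, Nat.abs_cast]
  gcongr
  exact hK j

theorem summable_tailVal (hx : |x| < 1) (hK : ∀ j, τ j ≤ K) (k : ℕ) :
    Summable fun j => (τ (k + 1 + j) : ℝ) * x ^ (j + 1) := by
  have := (summable_mul_pow (τ := fun j => τ (k + 1 + j)) hx fun j => hK _).mul_left x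
  exact this.congr fun j => by ring

theorem tailVal_succ (hx : |x| < 1) (hK : ∀ j, τ j ≤ K) (k : ℕ) :
    tailVal x τ k = x * (τ (k + 1) + tailVal x τ (k + 1)) := by
  rw [tailVal, (summable_tailVal hx hK k).tsum_eq_zero_add, tailVal, mul_add, ← tsum_mul_left]
  congr 1
  · simp [mul_comm]
  · refine tsum_congr fun j => ?_
    rw [show k + 1 + (j + 1) = k + 1 + 1 + j by ring]
    ring

theorem tailVal_zero_eq (hx : |x| < 1) (hK : ∀ j, τ j ≤ K) (k : ℕ) :
    tailVal x τ 0 = ∑ j ∈ Finset.range k, (τ (j + 1) : ℝ) * x ^ (j + 1) + x ^ k * tailVal x τ k := by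
  induction k with
  | zero => simp
  | succ k ih =>
    rw [ih, tailVal_succ hx hK k, Finset.sum_range_succ]
    ring

theorem eval_powers (hx : |x| < 1) (hK : ∀ j, τ j ≤ K) (h0 : τ 0 = 0) :
    eval (powers x) τ = tailVal x τ 0 := by
  simp only [eval, powers]
  rw [Summable.tsum_eq_zero_add (summable_mul_pow hx hK), h0, tailVal, Nat.cast_zero, zero_mul,
    zero_add]
  simp only [zero_add]
  exact tsum_congr fun j => by rw [add_comm 1 j]

theorem tailVal_nonneg (hω : 0 < ω) (k : ℕ) : 0 ≤ tailVal ω τ k :=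
  tsum_nonneg fun j => by positivity

theorem tailVal_le_bound (h0 : 0 < ω) (h1 : ω < 1) (hK : ∀ j, τ j ≤ K) (k : ℕ) :
    tailVal ω τ k ≤ K * ω / (1 - ω) := by
  have habs : |ω| < 1 := by rwa [abs_of_pos h0]
  have hg := (hasSum_geometric_of_lt_one h0.le h1).mul_left (K * ω)
  rw [div_eq_mul_inv]
  refine hasSum_le (fun j => ?_) (summable_tailVal habs hK k).hasSum hg
  rw [mul_assoc, ← pow_succ']
  gcongr
  exact hK _

theorem tailVal_congr {k k' : ℕ} (h : ∀ j, τ (k + 1 + j) = σ (k' + 1 + j)) :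
    tailVal x τ k = tailVal x σ k' := tsum_congr fun j => by rw [h]

/-- Iteration gives `d k ≥ ω ^ n * d (k + n) ≥ -C * ω ^ n`, which tends to 0. -/
theorem nonneg_of_mul_succ_le {d : ℕ → ℝ} {C : ℝ} (h0 : 0 < ω) (h1 : ω < 1)
    (hd : ∀ k, ω * d (k + 1) ≤ d k) (hC : ∀ k, -C ≤ d k) (k : ℕ) : 0 ≤ d k := by
  have key : ∀ n, ω ^ n * d (k + n) ≤ d k := by
    intro n
    induction n with
    | zero => simp
    | succ n ih =>
      refine le_trans ?_ ih
      rw [pow_succ, mul_assoc]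
      exact mul_le_mul_of_nonneg_left (hd (k + n)) (by positivity)
  have hlim : Tendsto (fun n : ℕ => ω ^ n * -C) atTop (𝓝 (0 * -C)) :=
    (tendsto_pow_atTop_nhds_zero_of_lt_one h0.le h1).mul_const _
  rw [zero_mul] at hlim
  refine le_of_tendsto' hlim fun n => le_trans ?_ (key n)
  exact mul_le_mul_of_nonneg_left (hC _) (by positivity)

/-- The remainder recursion has only one bounded solution: the difference of two solutions is
non-negative in both directions. -/
theorem eq_tailVal {y : ℕ → ℝ} {C : ℝ} (h0 : 0 < ω) (h1 : ω < 1) (hK : ∀ j, τ j ≤ K)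
    (hy : ∀ k, y k = ω * (τ (k + 1) + y (k + 1))) (hC : ∀ k, |y k| ≤ C) (k : ℕ) :
    y k = tailVal ω τ k := by
  have habs : |ω| < 1 := by rwa [abs_of_pos h0]
  have hb := tailVal_le_bound h0 h1 hK
  have hn := fun k => tailVal_nonneg (τ := τ) h0 k
  apply le_antisymm
  · have := nonneg_of_mul_succ_le (d := fun k => tailVal ω τ k - y k) (C := C) h0 h1
      (fun k => le_of_eq (by rw [tailVal_succ habs hK k, hy k]; ring))
      (fun k => by have := hn k; have := (abs_le.mp (hC k)).2; linarith) k
    linarith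
  · have := nonneg_of_mul_succ_le (d := fun k => y k - tailVal ω τ k)
      (C := C + K * ω / (1 - ω)) h0 h1
      (fun k => le_of_eq (by rw [tailVal_succ habs hK k, hy k]; ring))
      (fun k => by have := hb k; have := (abs_le.mp (hC k)).1; linarith) k
    linarith

end Values

/-! ### Digit systems whose maximal sequence has value 1 -/

/-- The sequence `0, B 0, B 1, …`. -/
def top (B : ℕ → ℕ) : ℕ → ℕ := fun k => if 1 ≤ k then B (k - 1) else 0

/-- A bounded digit sequence with infinitely many non-zero entries, the first one included, whose
value at `ω ∈ (0, 1)` is `1`. -/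
structure IsBase (B : ℕ → ℕ) (ω : ℝ) : Prop where
  pos : 0 < B 0
  inf : ∀ s, ∃ j ≥ s, 0 < B j
  bdd : ∃ K, ∀ j, B j ≤ K
  ω_pos : 0 < ω
  ω_lt : ω < 1
  total : tailVal ω (top B) 0 = 1

variable {B τ σ : ℕ → ℕ} {ω : ℝ}

theorem top_succ (k : ℕ) : top B (k + 1) = B k := rfl

theorem top_le {K : ℕ} (hK : ∀ j, B j ≤ K) (j : ℕ) : top B j ≤ K := by
  unfold top; split_ifs
  · exact hK _
  · exact Nat.zero_le _

theorem st_top (k : ℕ) : st B (top B) k = k := by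
  induction k with
  | zero => rfl
  | succ k ih => rw [st_succ_of_ge, ih]; rw [ih, top_succ]

theorem isAccepted_top : IsAccepted B (top B) :=
  ⟨rfl, fun k => by rw [st_top, top_succ]⟩

theorem IsAccepted.le {K : ℕ} (h : IsAccepted B τ) (hK : ∀ j, B j ≤ K) (j : ℕ) : τ j ≤ K := by
  cases j with
  | zero => rw [h.1]; exact Nat.zero_le _
  | succ j => exact (h.2 j).trans (hK _)

namespace IsBase

variable (h : IsBase B ω)
include h

theorem abs_lt : |ω| < 1 := by rw [abs_of_pos h.ω_pos]; exact h.ω_lt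

theorem T_succ (s : ℕ) : tailVal ω (top B) s = ω * (B s + tailVal ω (top B) (s + 1)) := by
  obtain ⟨K, hK⟩ := h.bdd
  rw [tailVal_succ h.abs_lt (top_le hK), top_succ]

theorem T_pos (s : ℕ) : 0 < tailVal ω (top B) s := by
  obtain ⟨K, hK⟩ := h.bdd
  have hω := h.ω_pos
  obtain ⟨j, hj, hpos⟩ := h.inf s
  refine (summable_tailVal h.abs_lt (top_le hK) s).tsum_pos (fun j => by positivity) (j - s) ?_
  rw [show s + 1 + (j - s) = j + 1 by omega, top_succ]
  positivity

theorem tailVal_succ {k : ℕ} (hτ : IsAccepted B τ) :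
    tailVal ω τ k = ω * (τ (k + 1) + tailVal ω τ (k + 1)) := by
  obtain ⟨K, hK⟩ := h.bdd
  exact Zeck.tailVal_succ h.abs_lt (hτ.le hK) k

/-- The defect is the largest tail allowed by the state minus the actual tail. When a block is
completed, the digit falls short by at least 1, which pays for resetting the allowance to the value
1 of a fresh maximal block; otherwise the digits agree. -/
theorem defect_succ (hτ : IsAccepted B τ) (k : ℕ) :
    ω * (tailVal ω (top B) (st B τ (k + 1)) - tailVal ω τ (k + 1)) ≤
      tailVal ω (top B) (st B τ k) - tailVal ω τ k := by
  have hω := h.ω_pos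
  have hT := h.T_pos (st B τ k + 1)
  rw [h.tailVal_succ (k := k) hτ, h.T_succ (st B τ k), ← mul_sub]
  refine mul_le_mul_of_nonneg_left ?_ hω.le
  rcases lt_or_ge (τ (k + 1)) (B (st B τ k)) with hlt | hge
  · have : (τ (k + 1) : ℝ) + 1 ≤ B (st B τ k) := by exact_mod_cast hlt
    rw [st_succ_of_lt hlt, h.total]
    linarith
  · have : (B (st B τ k) : ℝ) = τ (k + 1) := by exact_mod_cast le_antisymm hge (hτ.2 k)
    rw [st_succ_of_ge hge]
    linarith

theorem tailVal_le (hτ : IsAccepted B τ) (k : ℕ) :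
    tailVal ω τ k ≤ tailVal ω (top B) (st B τ k) := by
  obtain ⟨K, hK⟩ := h.bdd
  have := nonneg_of_mul_succ_le (d := fun k => tailVal ω (top B) (st B τ k) - tailVal ω τ k)
    (C := K * ω / (1 - ω)) h.ω_pos h.ω_lt (h.defect_succ hτ)
    (fun k => by
      have := h.T_pos (st B τ k)
      have := tailVal_le_bound h.ω_pos h.ω_lt (hτ.le hK) k
      linarith) k
  linarith

/-- A completed block leaves at least the surplus `T (s + 1) > 0`, where `T s` is the tail of `top
B` at `s`, and `defect_succ` carries positivity back to `k`. -/
theorem tailVal_lt (hτ : IsAccepted B τ) {k k' : ℕ} (hk : k < k') (h0 : st B τ k' = 0) :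
    tailVal ω τ k < tailVal ω (top B) (st B τ k) := by
  obtain ⟨n, rfl⟩ : ∃ n, k' = k + n + 1 := ⟨k' - k - 1, by omega⟩
  have hω := h.ω_pos
  have key : ∀ n, 0 < tailVal ω (top B) (st B τ (k + n)) - tailVal ω τ (k + n) →
      0 < tailVal ω (top B) (st B τ k) - tailVal ω τ k := by
    intro n
    induction n with
    | zero => exact id
    | succ n ih =>
      intro hpos
      exact ih (lt_of_lt_of_le (mul_pos hω hpos) (h.defect_succ hτ (k + n)))
  refine sub_pos.mp (key n ?_)
  have hlt := st_succ_eq_zero_iff.mp h0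
  have h1 : (τ (k + n + 1) : ℝ) + 1 ≤ B (st B τ (k + n)) := by exact_mod_cast hlt
  have hT := h.T_pos (st B τ (k + n) + 1)
  have h2 := h.tailVal_le hτ (k + n + 1)
  rw [h0, h.total] at h2
  rw [h.tailVal_succ hτ, h.T_succ (st B τ (k + n)), ← mul_sub]
  refine mul_pos hω ?_
  linarith

theorem eval_eq (hτ : IsAccepted B τ) : eval (powers ω) τ = tailVal ω τ 0 := by
  obtain ⟨K, hK⟩ := h.bdd
  exact eval_powers h.abs_lt (hτ.le hK) hτ.1

theorem eval_split (hτ : IsAccepted B τ) (k : ℕ) : eval (powers ω) τ =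
    ∑ j ∈ Finset.range k, (τ (j + 1) : ℝ) * ω ^ (j + 1) + ω ^ k * tailVal ω τ k := by
  obtain ⟨K, hK⟩ := h.bdd
  rw [h.eval_eq hτ, tailVal_zero_eq h.abs_lt (hτ.le hK)]

theorem eval_le_of_descLT (hτ : IsAccepted B τ) (hσ : IsAccepted B σ) (hlt : DescLT τ σ) :
    eval (powers ω) τ ≤ eval (powers ω) σ ∧
      ((∀ n, ∃ k, n < k ∧ st B τ k = 0) → eval (powers ω) τ < eval (powers ω) σ) := by
  obtain ⟨k, hk, hkk⟩ := hlt
  have hω := h.ω_pos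
  cases k with
  | zero => rw [hτ.1, hσ.1] at hkk; exact absurd hkk (lt_irrefl 0)
  | succ k =>
    have hst : st B τ k = st B σ k := st_congr (fun j _ hj => hk j (by omega)) k le_rfl
    -- The smaller sequence completes a block at the first difference, so its remaining tail is
    -- worth at most one unit of that digit.
    have h0 : st B τ (k + 1) = 0 := st_succ_of_lt (by rw [hst]; exact hkk.trans_le (hσ.2 k))
    have hsum : ∑ j ∈ Finset.range k, (τ (j + 1) : ℝ) * ω ^ (j + 1) =
        ∑ j ∈ Finset.range k, (σ (j + 1) : ℝ) * ω ^ (j + 1) :=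
      Finset.sum_congr rfl fun j hj => by rw [hk (j + 1) (by have := Finset.mem_range.mp hj; omega)]
    have hcast : (τ (k + 1) : ℝ) + 1 ≤ σ (k + 1) := by exact_mod_cast hkk
    have hσ0 := tailVal_nonneg (τ := σ) hω (k + 1)
    have hT := h.tailVal_le hτ (k + 1)
    have hp : 0 < ω ^ (k + 1) := by positivity
    rw [h0, h.total] at hT
    rw [h.eval_split hτ (k + 1), h.eval_split hσ (k + 1), Finset.sum_range_succ,
      Finset.sum_range_succ, hsum]
    refine ⟨?_, fun hinf => ?_⟩
    · nlinarith
    · obtain ⟨k', hk', hk0⟩ := hinf (k + 1)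
      have := h.tailVal_lt hτ hk' hk0
      rw [h0, h.total] at this
      nlinarith

theorem eval_lt_one (hτ : IsAccepted B τ) {k : ℕ} (hk : 0 < k) (h0 : st B τ k = 0) :
    eval (powers ω) τ < 1 := by
  rw [h.eval_eq hτ, ← h.total]
  exact h.tailVal_lt hτ hk h0

theorem eval_pos (hτ : IsAccepted B τ) (hne : τ ≠ 0) : 0 < eval (powers ω) τ := by
  obtain ⟨K, hK⟩ := h.bdd
  obtain ⟨k, hk⟩ := Function.ne_iff.mp hne
  have hω := h.ω_pos
  have : 0 < τ k := Nat.pos_of_ne_zero hk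
  exact (summable_mul_pow h.abs_lt (hτ.le hK)).tsum_pos
    (fun j => mul_nonneg (Nat.cast_nonneg _) (pow_nonneg hω.le _)) k
    (mul_pos (by exact_mod_cast this) (pow_pos hω _))

end IsBase

/-! ### Greedy expansion and comparison of sequences -/

/-- The states and remainders of the greedy expansion of `x`. -/
noncomputable def greedy (B : ℕ → ℕ) (ω x : ℝ) : ℕ → ℕ × ℝ
  | 0 => (0, x)
  | k + 1 =>
    let p := greedy B ω x k
    if p.2 / ω < B p.1 then (0, p.2 / ω - ⌊p.2 / ω⌋₊) else (p.1 + 1, p.2 / ω - B p.1)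

/-- The digits of the greedy expansion of `x`. -/
noncomputable def greedyDigit (B : ℕ → ℕ) (ω x : ℝ) : ℕ → ℕ
  | 0 => 0
  | k + 1 =>
    let p := greedy B ω x k
    if p.2 / ω < B p.1 then ⌊p.2 / ω⌋₊ else B p.1

theorem IsBase.exists_eval_eq (h : IsBase B ω) {x : ℝ} (h0 : 0 ≤ x) (h1 : x < 1) :
    ∃ τ, IsAccepted B τ ∧ (∀ n, ∃ k, n < k ∧ st B τ k = 0) ∧ eval (powers ω) τ = x := by
  have hω := h.ω_pos
  obtain ⟨K, hK⟩ := h.bdd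
  -- Invariant: the remainder is non-negative and strictly below the largest tail that the state
  -- allows.
  have hrange : ∀ k, 0 ≤ (greedy B ω x k).2 ∧
      (greedy B ω x k).2 < tailVal ω (top B) (greedy B ω x k).1 := by
    intro k
    induction k with
    | zero => exact ⟨h0, by rw [greedy, h.total]; exact h1⟩
    | succ k ih =>
      have hy : 0 ≤ (greedy B ω x k).2 / ω := div_nonneg ih.1 hω.le
      rw [greedy]
      split_ifs with hlt
      · dsimp only
        rw [h.total]
        have := Nat.floor_le hy
        have := Nat.lt_floor_add_one ((greedy B ω x k).2 / ω)
        constructor <;> linarith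
      · dsimp only
        have h2 := ih.2
        rw [h.T_succ, mul_comm, ← div_lt_iff₀ hω] at h2
        constructor <;> linarith
  have hst : ∀ k, st B (greedyDigit B ω x) k = (greedy B ω x k).1 := by
    intro k
    induction k with
    | zero => rfl
    | succ k ih =>
      have hy : 0 ≤ (greedy B ω x k).2 / ω := div_nonneg (hrange k).1 hω.le
      rw [st_succ, ih, greedyDigit, greedy]
      by_cases hlt : (greedy B ω x k).2 / ω < B (greedy B ω x k).1
      · rw [if_pos hlt, if_pos hlt, if_pos ((Nat.floor_lt hy).mpr hlt)]
      · rw [if_neg hlt, if_neg hlt, if_neg (lt_irrefl _)]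
  have hacc : IsAccepted B (greedyDigit B ω x) := by
    refine ⟨rfl, fun k => ?_⟩
    have hy : 0 ≤ (greedy B ω x k).2 / ω := div_nonneg (hrange k).1 hω.le
    rw [hst, greedyDigit]
    split_ifs with hlt
    · exact ((Nat.floor_lt hy).mpr hlt).le
    · exact le_rfl
  have hrec : ∀ k, (greedy B ω x k).2 =
      ω * (greedyDigit B ω x (k + 1) + (greedy B ω x (k + 1)).2) := by
    intro k
    rw [greedyDigit, greedy]
    split_ifs with hlt <;> field_simp <;> ring
  have hval : ∀ k, (greedy B ω x k).2 = tailVal ω (greedyDigit B ω x) k :=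
    eq_tailVal (C := K * ω / (1 - ω)) hω h.ω_lt (hacc.le hK) hrec fun k => by
      rw [abs_of_nonneg (hrange k).1]
      exact (hrange k).2.le.trans (tailVal_le_bound hω h.ω_lt (top_le hK) _)
  refine ⟨_, hacc, fun n => ?_, by rw [h.eval_eq hacc, ← hval]; rfl⟩
  -- Without further block ends the digits would copy the maximal sequence, and the remainder would
  -- equal the bound that it stays strictly below.
  by_contra! hno
  have hs := st_add_of_forall_ne_zero hno
  have := (hrange n).2
  rw [hval, ← hst] at this
  refine this.ne (tailVal_congr fun j => ?_)
  have h3 := hno (n + j + 1) (by omega)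
  have h4 := le_antisymm (hacc.2 (n + j)) (not_lt.mp fun hlt => h3 (st_succ_of_lt hlt))
  rw [show n + 1 + j = n + j + 1 by ring, h4, hs,
    show st B (greedyDigit B ω x) n + 1 + j = st B (greedyDigit B ω x) n + j + 1 by ring, top_succ]

theorem descLT_or_descLT (hne : τ ≠ σ) : DescLT τ σ ∨ DescLT σ τ := by
  classical
  have hex := Function.ne_iff.mp hne
  have hs := Nat.find_spec hex
  have hm := fun j => Nat.find_min (H := hex) (m := j)
  rcases lt_or_gt_of_ne hs with hlt | hgt
  · exact Or.inl ⟨_, fun j hj => not_not.mp (hm j hj), hlt⟩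
  · exact Or.inr ⟨_, fun j hj => (not_not.mp (hm j hj)).symm, hgt⟩

/-! ### The periodic digit sequence of a list -/

variable {N M : ℕ} {e e' : ℕ → ℕ}

theorem top_dig : top (dig N e) = maxBlock N e 1 := rfl

theorem dig_pos (he : e 1 ≠ 0) : 0 < dig N e 0 := by
  simp only [dig, Nat.zero_mod, zero_add]
  omega

theorem exists_dig_pos (hN : 0 < N) (he : e 1 ≠ 0) (s : ℕ) : ∃ j ≥ s, 0 < dig N e j :=
  ⟨N * s, Nat.le_mul_of_pos_left s hN, by simp only [dig, Nat.mul_mod_right, zero_add]; omega⟩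

theorem exists_dig_le (hN : 0 < N) : ∃ K, ∀ j, dig N e j ≤ K := by
  refine ⟨∑ j ∈ Finset.range N, e (j + 1), fun j => ?_⟩
  exact Finset.single_le_sum (f := fun j => e (j + 1)) (fun _ _ => Nat.zero_le _)
    (Finset.mem_range.mpr (Nat.mod_lt j hN))

theorem sum_Icc_one_eq {R : Type*} [AddCommMonoid R] (f : ℕ → R) (n : ℕ) :
    ∑ k ∈ Finset.Icc 1 n, f k = ∑ j ∈ Finset.range n, f (j + 1) := by
  induction n with
  | zero => simp
  | succ n ih => rw [Finset.sum_Icc_succ_top (by omega), ih, Finset.sum_range_succ]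

theorem charFun_eq (hN : 0 < N) (x : ℝ) :
    charFun N e x = 1 - x ^ N - ∑ j ∈ Finset.range N, (e (j + 1) : ℝ) * x ^ (j + 1) := by
  obtain ⟨n, rfl⟩ : ∃ n, N = n + 1 := ⟨N - 1, by omega⟩
  rw [charFun, Nat.add_sub_cancel, sum_Icc_one_eq, Finset.sum_range_succ]
  ring

/-- By periodicity the tail after `N` digits is the whole series again. The identity says f =
(1-x^N)(1-g), with g the value of the maximal block, and thus ties roots of f to g = 1. -/
theorem tailVal_maxBlock_mul (hN : 0 < N) {x : ℝ} (hx : |x| < 1) :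
    tailVal x (maxBlock N e 1) 0 * (1 - x ^ N) = 1 - x ^ N - charFun N e x := by
  obtain ⟨K, hK⟩ := exists_dig_le (e := e) hN
  have h1 := tailVal_zero_eq hx (top_le hK) N
  have h2 : tailVal x (top (dig N e)) N = tailVal x (top (dig N e)) 0 :=
    tailVal_congr fun j => by
      rw [show N + 1 + j = N + j + 1 by ring, show 0 + 1 + j = j + 1 by ring, top_succ, top_succ]
      simp [dig]
  rw [h2, Finset.sum_congr rfl (g := fun j => (e (j + 1) : ℝ) * x ^ (j + 1)) fun j hj => by
    rw [top_succ, dig, Nat.mod_eq_of_lt (Finset.mem_range.mp hj)], top_dig] at h1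
  rw [charFun_eq hN]
  linear_combination h1

theorem lt_one_of_charFun_nonneg (hN : 2 ≤ N) (he : e 1 ≠ 0) (hω : 0 < ω)
    (hr : 0 ≤ charFun N e ω) : ω < 1 := by
  by_contra! hge
  have h1 : (1 : ℝ) ≤ e 1 := by exact_mod_cast Nat.one_le_iff_ne_zero.mpr he
  have h2 : (e (0 + 1) : ℝ) * ω ^ (0 + 1) ≤ ∑ j ∈ Finset.range N, (e (j + 1) : ℝ) * ω ^ (j + 1) :=
    Finset.single_le_sum (f := fun j => (e (j + 1) : ℝ) * ω ^ (j + 1))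
      (fun j _ => by positivity) (Finset.mem_range.mpr (by omega))
  have h3 : 1 ≤ ω ^ N := one_le_pow₀ hge
  rw [charFun_eq (by omega)] at hr
  simp only [zero_add, pow_one] at h2
  nlinarith

theorem isBase_dig (hN : 2 ≤ N) (he : e 1 ≠ 0) (hω : 0 < ω) (hr : charFun N e ω = 0) :
    IsBase (dig N e) ω := by
  have h1 := lt_one_of_charFun_nonneg hN he hω hr.ge
  refine ⟨dig_pos he, exists_dig_pos (by omega) he, exists_dig_le (by omega), hω, h1, ?_⟩
  have h2 := tailVal_maxBlock_mul (N := N) (e := e) (by omega) (x := ω) (by rwa [abs_of_pos hω])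
  rw [hr, sub_zero] at h2
  have h3 : ω ^ N < 1 := pow_lt_one₀ hω.le h1 (by omega)
  rw [top_dig]
  exact mul_right_cancel₀ (sub_pos.mpr h3).ne' (by rw [h2, one_mul])

theorem isFundamentalSequence_powers (hN : 2 ≤ N) (he : e 1 ≠ 0) (h : IsBase (dig N e) ω) :
    IsFundamentalSequence (starColl N e) (powers ω) := by
  have hmem := fun ε => mem_starColl_iff (N := N) (e := e) (dig_pos he)
    (exists_dig_pos (by omega) he) (ε := ε)
  have hω := h.ω_pos
  obtain ⟨K, hK⟩ := h.bdd
  have hmono : ∀ ε ∈ starColl N e, ∀ δ ∈ starColl N e, DescLT ε δ →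
      eval (powers ω) ε < eval (powers ω) δ := fun ε hε δ hδ hlt =>
    (h.eval_le_of_descLT ((hmem ε).mp hε).2.1 ((hmem δ).mp hδ).2.1 hlt).2 ((hmem ε).mp hε).2.2
  refine ⟨fun n hn => ⟨pow_pos hω n, pow_lt_one₀ hω.le h.ω_lt (by omega)⟩,
    fun n _ => pow_lt_pow_right_of_lt_one₀ hω h.ω_lt n.lt_succ_self, fun ε hε => ?_,
    ⟨fun ε hε => ?_, fun ε hε δ hδ heq => ?_, fun x hx => ?_⟩, fun ε hε δ hδ => ?_⟩
  · exact summable_mul_pow h.abs_lt (((hmem ε).mp hε).2.1.le hK)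
  · obtain ⟨h1, h2, h3⟩ := (hmem ε).mp hε
    obtain ⟨k, hk, hk0⟩ := h3 0
    exact ⟨h.eval_pos h2 h1, h.eval_lt_one h2 hk hk0⟩
  · by_contra hne
    rcases descLT_or_descLT hne with hlt | hlt
    · exact (hmono ε hε δ hδ hlt).ne heq
    · exact (hmono δ hδ ε hε hlt).ne heq.symm
  · obtain ⟨τ, h1, h2, h3⟩ := h.exists_eval_eq hx.1.le hx.2
    refine ⟨τ, (hmem τ).mpr ⟨?_, h1, h2⟩, h3⟩
    rintro rfl
    have : eval (powers ω) 0 = 0 := by simp [eval]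
    exact hx.1.ne (this.symm.trans h3)
  · refine ⟨hmono ε hε δ hδ, fun hlt => ?_⟩
    rcases descLT_or_descLT (τ := ε) (σ := δ) (by rintro rfl; exact lt_irrefl _ hlt) with h1 | h1
    · exact h1
    · exact absurd (hmono δ hδ ε hε h1) (not_lt.mpr hlt.le)

end Zeck

namespace Zeck

/-! ### Sequences that end with a maximal block -/

/-- `ε` is parsed into proper blocks up to index `b`, and continues `B 0, B 1, …`. -/
def IsTail (B ε : ℕ → ℕ) (b : ℕ) : Prop :=
  IsAccepted B ε ∧ st B ε b = 0 ∧ ∀ k, ε (b + k + 1) = B k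

section Tails

variable {B B' τ ε δ : ℕ → ℕ} {b b' : ℕ} {ω : ℝ}

theorem IsTail.st_add (h : IsTail B ε b) (k : ℕ) : st B ε (b + k) = k := by
  induction k with
  | zero => exact h.2.1
  | succ k ih => rw [← add_assoc, st_succ_of_ge, ih]; rw [ih, h.2.2]

theorem IsTail.index_unique (h : IsTail B ε b) (h' : IsTail B ε b') : b = b' := by
  rcases le_total b b' with hle | hle
  · have := h.st_add (b' - b)
    rw [Nat.add_sub_cancel' hle, h'.2.1] at this
    omega
  · have := h'.st_add (b - b')
    rw [Nat.add_sub_cancel' hle, h.2.1] at this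
    omega

theorem IsTail.st_ne_zero (h : IsTail B ε b) {k : ℕ} (hk : b < k) : st B ε k ≠ 0 := by
  have := h.st_add (k - b)
  rw [Nat.add_sub_cancel' hk.le] at this
  omega

/-- After the last block end the parse never completes a block, so `τ` copies `B` from there on. -/
theorem exists_isTail (hτ : IsAccepted B τ) (h : ¬ ∀ n, ∃ k, n < k ∧ st B τ k = 0) :
    ∃ b, IsTail B τ b := by
  push Not at h
  obtain ⟨n, hn⟩ := h
  have hs := st_sub_add (B := B) (τ := τ) n 0 (Nat.zero_le _)
  have hle := st_le (B := B) (τ := τ) n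
  have hst : ∀ k, st B τ (n - st B τ n + k) = k := by
    intro k
    rcases Nat.le_total k (st B τ n) with hk | hk
    · exact st_sub_add n k hk
    · have := st_add_of_forall_ne_zero hn (k - st B τ n)
      rw [show n + (k - st B τ n) = n - st B τ n + k by omega] at this
      omega
  refine ⟨n - st B τ n, hτ, hs, fun k => ?_⟩
  have h1 := hτ.2 (n - st B τ n + k)
  rw [hst] at h1
  refine le_antisymm h1 (not_lt.mp fun hlt => ?_)
  have h2 := hst (k + 1)
  rw [← add_assoc, st_succ_of_lt (by rwa [hst])] at h2
  omega

/-- The sequence that agrees with `τ` up to `b` and continues `B 0, B 1, …`. -/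
def graft (B τ : ℕ → ℕ) (b : ℕ) : ℕ → ℕ := fun k => if k ≤ b then τ k else B (k - b - 1)

theorem graft_of_le {k : ℕ} (hk : k ≤ b) : graft B τ b k = τ k := if_pos hk

theorem graft_add (k : ℕ) : graft B τ b (b + k + 1) = B k := by
  rw [graft, if_neg (by omega)]
  congr 1
  omega

theorem isTail_graft (h0 : τ 0 = 0) (hτ : IsAcceptedUpTo B τ b) (hb : st B τ b = 0) :
    IsTail B (graft B τ b) b := by
  have hst : ∀ k ≤ b, st B (graft B τ b) k = st B τ k :=
    st_congr fun j _ hj => graft_of_le hj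
  have hadd : ∀ k, st B (graft B τ b) (b + k) = k := by
    intro k
    induction k with
    | zero => rw [add_zero, hst b le_rfl, hb]
    | succ k ih => rw [← add_assoc, st_succ_of_ge, ih]; rw [ih, graft_add]
  refine ⟨⟨by rw [graft_of_le (Nat.zero_le _), h0], fun k => ?_⟩, hadd 0, graft_add⟩
  rcases Nat.lt_or_ge k b with hk | hk
  · rw [hst k hk.le, graft_of_le hk]
    exact hτ k hk
  · obtain ⟨j, rfl⟩ := Nat.exists_eq_add_of_le hk
    rw [hadd, graft_add]

theorem res_add_basis_of_lt {k : ℕ} (hk : k < b) : (res b ε + basis b) k = ε k := by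
  simp [res, basis, hk.le, hk.ne]

theorem res_add_basis_self : (res b ε + basis b) b = ε b + 1 := by
  simp [res, basis]

theorem res_add_basis_of_gt {k : ℕ} (hk : b < k) : (res b ε + basis b) k = 0 := by
  simp [res, basis, hk.not_ge, hk.ne']

/-- A block end at `b` means that the digit there is strictly below the one due, which leaves room
for one more unit. -/
theorem isAccepted_res_add_basis (h : IsAccepted B ε) (hb : 1 ≤ b) (h0 : st B ε b = 0) :
    IsAccepted B (res b ε + basis b) := by
  obtain ⟨c, rfl⟩ : ∃ c, b = c + 1 := ⟨b - 1, by omega⟩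
  have hst : ∀ k ≤ c, st B (res (c + 1) ε + basis (c + 1)) k = st B ε k :=
    st_congr fun j _ hj => res_add_basis_of_lt (by omega)
  refine ⟨by rw [res_add_basis_of_lt (by omega), h.1], fun k => ?_⟩
  rcases lt_trichotomy k c with hk | rfl | hk
  · rw [hst k hk.le, res_add_basis_of_lt (by omega)]
    exact h.2 k
  · rw [hst k le_rfl, res_add_basis_self]
    exact st_succ_eq_zero_iff.mp h0
  · rw [res_add_basis_of_gt (by omega)]
    exact Nat.zero_le _

/-! ### Comparison of two parsings -/

/-- Every block end of the smaller parse is one of the larger parse: the last digit can be raised by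
1 and stay accepted by `B`, hence by `B'`, so the original digit was below the one due for `B'`. -/
theorem st_eq_zero_of_imp (H : ∀ τ p, IsAcceptedUpTo B τ p → IsAcceptedUpTo B' τ p)
    {k : ℕ} (hτ : IsAcceptedUpTo B τ k) (h0 : st B τ k = 0) : st B' τ k = 0 := by
  cases k with
  | zero => rfl
  | succ k =>
    have hlt := st_succ_eq_zero_iff.mp h0
    have hne : ∀ j, j ≤ k → τ j = Function.update τ (k + 1) (τ (k + 1) + 1) j := fun j hj =>
      (Function.update_of_ne (by omega) _ _).symm
    have hst := fun B => st_congr (B := B) (fun j _ hj => hne j hj) k le_rfl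
    have := H (Function.update τ (k + 1) (τ (k + 1) + 1)) (k + 1) (fun j hj => ?_) k (by omega)
    · rw [← hst, Function.update_self] at this
      exact st_succ_of_lt this
    · rcases Nat.lt_or_ge j k with hjk | hjk
      · rw [← hne (j + 1) hjk, ← st_congr (fun j _ hj => hne j hj) j hjk.le]
        exact hτ j hj
      · obtain rfl : j = k := by omega
        rw [← hst, Function.update_self]
        exact hlt

theorem IsAccepted.of_imp (H : ∀ τ p, IsAcceptedUpTo B τ p → IsAcceptedUpTo B' τ p)
    (hτ : IsAccepted B τ) : IsAccepted B' τ :=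
  ⟨hτ.1, fun k => H τ (k + 1) (hτ.upTo _) k (by omega)⟩

/-! ### Values of sequences that end with a maximal block -/

/-- For `b = 0` the unit sits at the unused index 0 and contributes `x ^ 0 = 1`, which is the right
end point prescribed in that case. -/
theorem eval_res_add_basis {x : ℝ} {K : ℕ} (hx : |x| < 1) (hK : ∀ j, ε j ≤ K) (h0 : ε 0 = 0) :
    eval (powers x) (res b ε + basis b) =
      ∑ j ∈ Finset.range b, (ε (j + 1) : ℝ) * x ^ (j + 1) + x ^ b := by
  have hres : ∀ j, res b ε j ≤ K := fun j => by
    unfold res; split_ifs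
    · exact hK j
    · exact Nat.zero_le _
  have hbas : ∀ j, basis b j ≤ 1 := fun j => by
    unfold basis; split_ifs <;> simp
  have h1 : eval (powers x) (res b ε) =
      ∑ j ∈ Finset.range b, (ε (j + 1) : ℝ) * x ^ (j + 1) := by
    rw [eval_powers hx hres (by simp [res, h0]), tailVal_zero_eq hx hres b]
    have : tailVal x (res b ε) b = 0 := by
      rw [tailVal]
      convert tsum_zero with j
      simp [res, show ¬ b + 1 + j ≤ b by omega]
    rw [this, mul_zero, add_zero]
    refine Finset.sum_congr rfl fun j hj => ?_
    rw [res, if_pos (by have := Finset.mem_range.mp hj; omega)]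
  have h2 : eval (powers x) (basis b) = x ^ b := by
    rw [eval, tsum_eq_single b]
    · simp [basis, powers]
    · intro j hj
      simp [basis, hj]
  have h3 : eval (powers x) (res b ε + basis b) =
      eval (powers x) (res b ε) + eval (powers x) (basis b) := by
    simp only [eval, powers]
    rw [← (summable_mul_pow hx hres).tsum_add (summable_mul_pow hx hbas)]
    refine tsum_congr fun j => ?_
    rw [Pi.add_apply]
    push_cast
    ring
  rw [h3, h1, h2]

theorem IsTail.tailVal_eq {x : ℝ} (h : IsTail B ε b) : tailVal x ε b = tailVal x (top B) 0 :=
  tailVal_congr fun j => by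
    rw [show b + 1 + j = b + j + 1 by ring, h.2.2, show 0 + 1 + j = j + 1 by ring, top_succ]

variable (hbase : IsBase B' ω) (H : ∀ τ p, IsAcceptedUpTo B τ p → IsAcceptedUpTo B' τ p)
include hbase H

theorem IsTail.right_sub_left (h : IsTail B ε b) :
    eval (powers ω) (res b ε + basis b) - eval (powers ω) ε =
      ω ^ b * (1 - tailVal ω (top B) 0) := by
  obtain ⟨K, hK⟩ := hbase.bdd
  have h' := h.1.of_imp H
  rw [eval_res_add_basis hbase.abs_lt (h'.le hK) h'.1, hbase.eval_split h' b, h.tailVal_eq]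
  ring

/-- The maximal sequence of `B` is accepted by `B'`. If the larger parse never completed a block on
it, it would copy `B'` throughout; so it has a block end, and its value is below 1. -/
theorem tailVal_top_lt_one (hne : top B ≠ top B') : tailVal ω (top B) 0 < 1 := by
  have hacc := (isAccepted_top (B := B)).of_imp H
  suffices ∃ k, 0 < k ∧ st B' (top B) k = 0 by
    obtain ⟨k, hk, h0⟩ := this
    rw [← hbase.eval_eq hacc]
    exact hbase.eval_lt_one hacc hk h0
  by_contra! hno
  refine hne (funext fun k => ?_)
  cases k with
  | zero => rfl
  | succ k =>
    have h1 := st_add_of_forall_ne_zero hno k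
    have h2 := hacc.2 k
    rw [zero_add, st_zero, zero_add] at h1
    rw [h1] at h2
    refine le_antisymm h2 (not_lt.mp fun hlt => hno (k + 1) (by omega) (st_succ_of_lt ?_))
    rwa [h1]

theorem IsTail.right_le_of_descLT (h : IsTail B ε b) (hδ : IsAccepted B δ) (hlt : DescLT ε δ) :
    eval (powers ω) (res b ε + basis b) ≤ eval (powers ω) δ := by
  obtain ⟨k, hk, hkk⟩ := hlt
  -- Past `b` the digits of `ε` are already the largest that the parse permits.
  have hkb : k ≤ b := by
    by_contra! hbk
    obtain ⟨j, rfl⟩ : ∃ j, k = b + j + 1 := ⟨k - b - 1, by omega⟩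
    have h1 := hδ.2 (b + j)
    rw [← st_congr (τ := ε) (p := b + j) (fun j _ hj => hk j (by omega)) _ le_rfl, h.st_add] at h1
    rw [h.2.2] at hkk
    omega
  have hk1 : 1 ≤ k := by
    by_contra! hk0
    obtain rfl : k = 0 := by omega
    rw [h.1.1, hδ.1] at hkk
    exact lt_irrefl 0 hkk
  have hacc := (isAccepted_res_add_basis h.1 (by omega) h.2.1).of_imp H
  have hδ' := hδ.of_imp H
  -- If `k = b` and `δ` exceeds `ε` by exactly 1 there, then `δ` may have further non-zero digits or
  -- none, and a digitwise comparison replaces the lexicographical one.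
  have hcases : DescLT (res b ε + basis b) δ ∨ ∀ j, (res b ε + basis b) j ≤ δ j := by
    rcases hkb.lt_or_eq with hlt | rfl
    · refine Or.inl ⟨k, fun j hj => ?_, ?_⟩
      · rw [res_add_basis_of_lt (by omega), hk j hj]
      · rwa [res_add_basis_of_lt hlt]
    · rcases Nat.lt_or_ge (ε k + 1) (δ k) with hlt | hge
      · refine Or.inl ⟨k, fun j hj => ?_, ?_⟩
        · rw [res_add_basis_of_lt (by omega), hk j hj]
        · rwa [res_add_basis_self]
      · refine Or.inr fun j => ?_
        rcases lt_trichotomy j k with hj | rfl | hj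
        · rw [res_add_basis_of_lt hj, hk j hj]
        · rw [res_add_basis_self]
          exact hkk
        · rw [res_add_basis_of_gt hj]
          exact Nat.zero_le _
  rcases hcases with hlt | hle
  · exact (hbase.eval_le_of_descLT hacc hδ' hlt).1
  · obtain ⟨K, hK⟩ := hbase.bdd
    have hω := hbase.ω_pos
    refine (summable_mul_pow hbase.abs_lt (hacc.le hK)).tsum_le_tsum (fun j => ?_)
      (summable_mul_pow hbase.abs_lt (hδ'.le hK))
    have : ((res b ε + basis b) j : ℝ) ≤ δ j := by exact_mod_cast hle j
    exact mul_le_mul_of_nonneg_right this (pow_nonneg hω.le j)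

theorem IsTail.eval_notMem_Ioo (h : IsTail B ε b) (hδ : IsAccepted B δ) :
    eval (powers ω) δ ∉
      Ioo (eval (powers ω) ε) (eval (powers ω) (res b ε + basis b)) := by
  rintro ⟨h1, h2⟩
  by_cases hne : ε = δ
  · rw [hne] at h1
    exact lt_irrefl _ h1
  rcases descLT_or_descLT hne with hlt | hlt
  · exact (h.right_le_of_descLT hbase H hδ hlt).not_gt h2
  · exact (hbase.eval_le_of_descLT (hδ.of_imp H) (h.1.of_imp H) hlt).1.not_gt h1

theorem IsTail.disjoint_Ioo (h : IsTail B ε b) (h' : IsTail B δ b') (hne : ε ≠ δ) :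
    Disjoint (Ioo (eval (powers ω) ε) (eval (powers ω) (res b ε + basis b)))
      (Ioo (eval (powers ω) δ) (eval (powers ω) (res b' δ + basis b'))) := by
  rw [Set.disjoint_left]
  rintro x ⟨h1, h2⟩ ⟨h3, h4⟩
  rcases descLT_or_descLT hne with hlt | hlt
  · have := h.right_le_of_descLT hbase H h'.1 hlt
    linarith
  · have := h'.right_le_of_descLT hbase H h.1 hlt
    linarith

theorem IsTail.right_le_one (hinf : ∀ s, ∃ j ≥ s, 0 < B' j) (h : IsTail B ε b) :
    eval (powers ω) (res b ε + basis b) ≤ 1 := by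
  rcases Nat.eq_zero_or_pos b with rfl | hb
  · obtain ⟨K, hK⟩ := hbase.bdd
    rw [eval_res_add_basis hbase.abs_lt ((h.1.of_imp H).le hK) h.1.1]
    simp
  · obtain ⟨k, hk, h0⟩ := exists_st_eq_zero_of_zeros hinf
      (fun k hk => res_add_basis_of_gt (ε := ε) (b := b) hk) 0
    exact (hbase.eval_lt_one ((isAccepted_res_add_basis h.1 hb h.2.1).of_imp H) hk h0).le

theorem exists_isTail_of_not_isAccepted (hτ : IsAccepted B' τ)
    (hinf : ∀ n, ∃ k, n < k ∧ st B' τ k = 0) (hno : ¬ IsAccepted B τ) :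
    ∃ ε b, IsTail B ε b ∧ DescLT ε τ ∧
      eval (powers ω) τ < eval (powers ω) (res b ε + basis b) := by
  classical
  have hex : ∃ k, ¬ τ (k + 1) ≤ B (st B τ k) := by
    by_contra! hall
    exact hno ⟨hτ.1, hall⟩
  have hspec := Nat.find_spec hex
  have hmin : IsAcceptedUpTo B τ (Nat.find hex) := fun j hj => not_not.mp (Nat.find_min hex hj)
  set k := Nat.find hex
  have hle := st_le (B := B) (τ := τ) k
  have hb0 := st_sub_add (B := B) (τ := τ) k 0 (Nat.zero_le _)
  rw [add_zero] at hb0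
  -- The last block end before the first digit that the smaller parse rejects.
  obtain ⟨b, hb⟩ : ∃ b, b = k - st B τ k := ⟨_, rfl⟩
  rw [← hb] at hb0
  have hbacc : IsAcceptedUpTo B τ b := fun j hj => hmin j (by omega)
  have htail := isTail_graft hτ.1 hbacc hb0
  refine ⟨graft B τ b, b, htail, ⟨k + 1, fun j hj => ?_, ?_⟩, ?_⟩
  · rcases Nat.lt_or_ge b j with hlt | hge
    · obtain ⟨i, rfl⟩ : ∃ i, j = b + i + 1 := ⟨j - b - 1, by omega⟩
      rw [graft_add, hb, hmin.eq_of_lt_st (by omega)]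
    · exact graft_of_le hge
  · rw [show k + 1 = b + st B τ k + 1 by omega, graft_add, show b + st B τ k = k by omega]
    exact not_le.mp hspec
  · obtain ⟨K, hK⟩ := hbase.bdd
    have hacc' := htail.1.of_imp H
    -- Since `b` is also a block end for `B'`, the digits of `τ` after `b` are worth less than `ω ^
    -- b`.
    have hst : st B' τ b = 0 := by
      rw [← st_eq_zero_of_imp H (htail.1.upTo b) htail.2.1]
      exact st_congr (fun j _ hj => (graft_of_le hj).symm) b le_rfl
    obtain ⟨k', hk', h0⟩ := hinf b
    have hlt := hbase.tailVal_lt hτ hk' h0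
    rw [hst, hbase.total] at hlt
    rw [eval_res_add_basis hbase.abs_lt (hacc'.le hK) hacc'.1, hbase.eval_split hτ b,
      Finset.sum_congr rfl (f := fun j => (graft B τ b (j + 1) : ℝ) * ω ^ (j + 1))
        (g := fun j => (τ (j + 1) : ℝ) * ω ^ (j + 1)) fun j hj => by
        rw [graft_of_le (by have := Finset.mem_range.mp hj; omega)]]
    have := pow_pos hbase.ω_pos b
    nlinarith

omit hbase in
-- The larger parse restarts at `b` and then reads `top B`, so it inherits infinitely many block
-- ends. This makes the comparison at the left end of a gap strict and excludes left end points from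
-- U.
theorem IsTail.exists_st_eq_zero (htop : ∀ n, ∃ k, n < k ∧ st B' (top B) k = 0)
    (h : IsTail B ε b) (n : ℕ) : ∃ k, n < k ∧ st B' ε k = 0 := by
  have h0 := st_eq_zero_of_imp H (h.1.upTo b) h.2.1
  obtain ⟨k, hk, hk0⟩ := htop n
  refine ⟨b + k, by omega, ?_⟩
  rw [Zeck.st_add h0, ← hk0]
  refine st_congr (fun j hj _ => ?_) k le_rfl
  obtain ⟨i, rfl⟩ : ∃ i, j = i + 1 := ⟨j - 1, by omega⟩
  rw [top_succ, ← add_assoc, h.2.2]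

end Tails

/-! ### The closure of a collection -/

section Closure

variable {N : ℕ} {e : ℕ → ℕ} {ε ε₀ : ℕ → ℕ} {b : ℕ}

theorem res_mem_blockSums (hB : 0 < dig N e 0) (h : IsAccepted (dig N e) ε)
    (h0 : st (dig N e) ε b = 0) : res b ε ∈ blockSums N e b := by
  have hres : ∀ k ≤ b, res b ε k = ε k := fun k hk => if_pos hk
  have hres' : ∀ k, b < k → res b ε k = 0 := fun k hk => if_neg (by omega)
  have hst := st_congr (B := dig N e) (fun k _ hk => hres k hk)
  refine (mem_blockSums_iff hB).mpr
    ⟨⟨by rw [hres 0 (Nat.zero_le _), h.1], fun k => ?_⟩, by rw [hst b le_rfl, h0], hres'⟩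
  rcases Nat.lt_or_ge k b with hk | hk
  · rw [hres _ hk, hst k hk.le]
    exact h.2 k
  · rw [hres' (k + 1) (by omega)]
    exact Nat.zero_le _

theorem isTail_iff (hB : 0 < dig N e 0) :
    (ε₀ ∈ blockSums N e b ∧ ε = ε₀ + maxBlock N e (b + 1)) ↔
      IsTail (dig N e) ε b ∧ ε₀ = res b ε := by
  rw [mem_blockSums_iff hB]
  constructor
  · rintro ⟨⟨h1, h2, h3⟩, rfl⟩
    have hg : ε₀ + maxBlock N e (b + 1) = graft (dig N e) ε₀ b := by
      funext k
      rw [Pi.add_apply, maxBlock_apply, graft]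
      rcases Nat.lt_or_ge b k with hk | hk
      · rw [if_pos (show b + 1 ≤ k from hk), if_neg (by omega), h3 k hk, zero_add, Nat.sub_sub]
      · rw [if_neg (by omega), if_pos hk, add_zero]
    refine ⟨hg ▸ isTail_graft h1.1 (h1.upTo b) h2, funext fun k => ?_⟩
    rw [res]
    split_ifs with hk
    · rw [Pi.add_apply, maxBlock_apply, if_neg (by omega), add_zero]
    · exact h3 k (by omega)
  · rintro ⟨h, rfl⟩
    refine ⟨(mem_blockSums_iff hB).mp (res_mem_blockSums hB h.1 h.2.1), funext fun k => ?_⟩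
    rw [Pi.add_apply, maxBlock_apply, res]
    rcases Nat.lt_or_ge b k with hk | hk
    · obtain ⟨j, rfl⟩ : ∃ j, k = b + j + 1 := ⟨k - b - 1, by omega⟩
      rw [if_neg (by omega), if_pos (by omega), h.2.2, zero_add]
      congr 1
      omega
    · rw [if_pos hk, if_neg (by omega), add_zero]

variable (hN : 2 ≤ N) (he : e 1 ≠ 0)
include hN he

theorem mem_starClosure_diff_iff :
    ε ∈ starClosure N e \ starColl N e ↔ ∃ b, IsTail (dig N e) ε b := by
  have hB := dig_pos (N := N) he
  constructor
  · rintro ⟨h1 | ⟨b, ε₀, h1⟩, h2⟩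
    · exact absurd h1 h2
    · exact ⟨b, ((isTail_iff hB).mp h1).1⟩
  · rintro ⟨b, h⟩
    refine ⟨Or.inr ⟨b, res b ε, (isTail_iff hB).mpr ⟨h, rfl⟩⟩, fun hmem => ?_⟩
    obtain ⟨k, hk, h0⟩ := ((mem_starColl_iff hB (exists_dig_pos (by omega) he)).mp hmem).2.2 b
    exact h.st_ne_zero hk h0

theorem mem_starClosure_iff : ε ∈ starClosure N e ↔ ε ≠ 0 ∧ IsAccepted (dig N e) ε := by
  have hB := dig_pos (N := N) he
  have hmem := mem_starColl_iff hB (exists_dig_pos (by omega) he) (ε := ε)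
  constructor
  · intro h
    by_cases hc : ε ∈ starColl N e
    · exact ⟨(hmem.mp hc).1, (hmem.mp hc).2.1⟩
    · obtain ⟨b, hb⟩ := (mem_starClosure_diff_iff hN he).mp ⟨h, hc⟩
      refine ⟨?_, hb.1⟩
      rintro rfl
      have := hb.2.2 0
      rw [Pi.zero_apply] at this
      omega
  · rintro ⟨h1, h2⟩
    by_cases hinf : ∀ n, ∃ k, n < k ∧ st (dig N e) ε k = 0
    · exact Or.inl (hmem.mpr ⟨h1, h2, hinf⟩)
    · exact ((mem_starClosure_diff_iff hN he).mpr (exists_isTail h2 hinf)).1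

omit hN in
theorem tailIndex_eq (h : IsTail (dig N e) ε b) : tailIndex N e ε = b := by
  have : {b | ∃ ε₀ ∈ blockSums N e b, ε = ε₀ + maxBlock N e (b + 1)} = {b} := by
    ext b'
    constructor
    · rintro ⟨ε₀, h'⟩
      exact ((isTail_iff (dig_pos he)).mp h').1.index_unique h
    · rintro rfl
      exact ⟨res b' ε, (isTail_iff (dig_pos he)).mpr ⟨h, rfl⟩⟩
  rw [tailIndex, this, csInf_singleton]

omit hN in
theorem rightEnd_eq {ω : ℝ} (h : IsTail (dig N e) ε b) :
    rightEnd N e ω ε = eval (powers ω) (res b ε + basis b) := by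
  rw [rightEnd, tailIndex_eq he h]

theorem isTail_unique_and_mem (hε : ε ∈ starClosure N e \ starColl N e) :
    (∃! p : ℕ × (ℕ → ℕ), p.2 ∈ blockSums N e p.1 ∧ ε = p.2 + maxBlock N e (p.1 + 1)) ∧
      ∀ b, 1 ≤ b → ∀ ε₀ ∈ blockSums N e b, ε = ε₀ + maxBlock N e (b + 1) →
        ε₀ + basis b ∈ starColl N e := by
  have hB := dig_pos (N := N) he
  have hinf := exists_dig_pos (N := N) (by omega) he
  constructor
  · obtain ⟨b, h⟩ := (mem_starClosure_diff_iff hN he).mp hε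
    refine ⟨(b, res b ε), (isTail_iff hB).mpr ⟨h, rfl⟩, ?_⟩
    rintro ⟨b', ε₀⟩ h'
    obtain ⟨h1, h2⟩ := (isTail_iff hB).mp h'
    obtain rfl : b' = b := h1.index_unique h
    exact Prod.ext rfl h2
  · intro b hb ε₀ h1 h2
    obtain ⟨h, rfl⟩ := (isTail_iff hB).mp ⟨h1, h2⟩
    refine (mem_starColl_iff hB hinf).mpr ⟨fun h0 => ?_, isAccepted_res_add_basis h.1 hb h.2.1,
      exists_st_eq_zero_of_zeros hinf fun k hk => res_add_basis_of_gt hk⟩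
    have := congrFun h0 b
    rw [res_add_basis_self, Pi.zero_apply] at this
    omega

omit hN he in
theorem rho_eq {ω : ℝ} (hN : 0 < N) (hω : |ω| < 1) :
    rho N e ω = tailVal ω (maxBlock N e 1) 0 := by
  obtain ⟨K, hK⟩ := exists_dig_le (e := e) hN
  exact eval_powers hω (top_le hK) rfl

omit he in
theorem gapLength_eq {ω : ℝ} (hω : |ω| < 1) (b : ℕ) :
    gapLength N e ω b = ω ^ b * (1 - rho N e ω) := by
  obtain ⟨K, hK⟩ := exists_dig_le (N := N) (e := e) (by omega)
  have hle : ∀ j, maxBlock N e (b + 1) j ≤ K := fun j => by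
    rw [maxBlock_apply]; split_ifs
    · exact hK _
    · exact Nat.zero_le _
  rw [gapLength, rho_eq (by omega) hω, eval_powers hω hle (by simp [maxBlock]),
    tailVal_zero_eq hω hle b, Finset.sum_eq_zero, zero_add]
  · rw [tailVal_congr (k' := 0) (σ := maxBlock N e 1)]
    · ring
    · intro j
      rw [maxBlock_apply, maxBlock_apply, if_pos (by omega), if_pos (by omega)]
      congr 1
      omega
  · intro j hj
    rw [maxBlock_apply, if_neg (by have := Finset.mem_range.mp hj; omega), Nat.cast_zero, zero_mul]

end Closure

end Zeck

namespace Zeck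

/-! ### Counting sums of blocks -/

section Counting

variable {N : ℕ} {e : ℕ → ℕ} {ε ε₀ : ℕ → ℕ}

theorem blockSums_finite (hN : 0 < N) (he : e 1 ≠ 0) (n : ℕ) : (blockSums N e n).Finite := by
  obtain ⟨K, hK⟩ := exists_dig_le (e := e) hN
  have hmem := fun ε => mem_blockSums_iff (N := N) (e := e) (dig_pos he) (n := n) (ε := ε)
  refine Set.Finite.of_finite_image (f := fun ε (i : Fin (n + 1)) => ε i)
    ((Set.Finite.pi' fun _ : Fin (n + 1) => Set.finite_Iic K).subset ?_) fun ε hε δ hδ heq => ?_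
  · rintro _ ⟨ε, hε, rfl⟩ i
    exact ((hmem ε).mp hε).1.le hK _
  · funext k
    rcases Nat.lt_or_ge n k with hk | hk
    · rw [((hmem ε).mp hε).2.2 k hk, ((hmem δ).mp hδ).2.2 k hk]
    · exact congrFun heq ⟨k, by omega⟩

theorem blockCount_zero (he : e 1 ≠ 0) : blockCount N e 0 = 1 := by
  have : blockSums N e 0 = {0} := by
    ext ε
    rw [mem_blockSums_iff (dig_pos he), Set.mem_singleton_iff]
    constructor
    · rintro ⟨h1, -, h3⟩
      funext k
      rcases Nat.eq_zero_or_pos k with rfl | hk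
      · exact h1.1
      · exact h3 k hk
    · rintro rfl
      exact ⟨⟨rfl, fun k => Nat.zero_le _⟩, rfl, fun k _ => rfl⟩
  rw [blockCount, this, Set.ncard_singleton]

/-- The last block has its final digit at `n + 1` after `s` copied digits. The element is determined
by its part before that block and by the final digit, which may be any number below `dig N e s`. -/
theorem ncard_blockSums_fiber (he : e 1 ≠ 0) {n s : ℕ} (hs : s ≤ n) :
    {ε ∈ blockSums N e (n + 1) | st (dig N e) ε n = s}.ncard =
      dig N e s * blockCount N e (n - s) := by
  have hB := dig_pos (N := N) he
  have hiff := fun n ε => mem_blockSums_iff (N := N) (e := e) hB (n := n) (ε := ε)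
  have hcard : (blockSums N e (n - s) ×ˢ Set.Iio (dig N e s)).ncard =
      dig N e s * blockCount N e (n - s) := by
    rw [Set.ncard_prod, mul_comm, blockCount, Set.ncard_eq_toFinset_card']
    simp
  rw [← hcard]
  refine Set.ncard_congr (fun ε _ => (res (n - s) ε, ε (n + 1))) ?_ ?_ ?_
  · rintro ε ⟨hε, rfl⟩
    obtain ⟨h1, h2, -⟩ := (hiff _ ε).mp hε
    have := st_sub_add (B := dig N e) (τ := ε) n 0 (Nat.zero_le _)
    exact ⟨res_mem_blockSums hB h1 this, st_succ_eq_zero_iff.mp h2⟩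
  · rintro ε δ ⟨hε, h1⟩ ⟨hδ, h2⟩ heq
    obtain ⟨h3, h4⟩ := Prod.mk.inj heq
    funext k
    rcases lt_trichotomy k (n + 1) with hk | rfl | hk
    · rcases Nat.lt_or_ge (n - s) k with hlt | hge
      · have h5 := (((hiff _ ε).mp hε).1.upTo n).eq_of_lt_st (j := k - (n - s) - 1) (by omega)
        have h6 := (((hiff _ δ).mp hδ).1.upTo n).eq_of_lt_st (j := k - (n - s) - 1) (by omega)
        rw [h1, show n - s + (k - (n - s) - 1) + 1 = k by omega] at h5
        rw [h2, show n - s + (k - (n - s) - 1) + 1 = k by omega] at h6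
        rw [h5, h6]
      · have := congrFun h3 k
        rwa [res, res, if_pos hge, if_pos hge] at this
    · exact h4
    · rw [((hiff _ ε).mp hε).2.2 k hk, ((hiff _ δ).mp hδ).2.2 k hk]
  · rintro ⟨ε₀, d⟩ ⟨h1, h2⟩
    dsimp only at h1 h2
    rw [Set.mem_Iio] at h2
    obtain ⟨h3, h4, h5⟩ := (hiff _ ε₀).mp h1
    have htail := isTail_graft h3.1 (h3.upTo _) h4
    obtain ⟨δ, hδ⟩ : ∃ δ : ℕ → ℕ, δ = fun k =>
      if k ≤ n then graft (dig N e) ε₀ (n - s) k else if k = n + 1 then d else 0 := ⟨_, rfl⟩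
    have hlow : ∀ k ≤ n, δ k = graft (dig N e) ε₀ (n - s) k := fun k hk => by
      rw [hδ]; exact if_pos hk
    have hmid : δ (n + 1) = d := by rw [hδ]; simp
    have hhigh : ∀ k, n + 1 < k → δ k = 0 := fun k hk => by
      rw [hδ]
      dsimp only
      rw [if_neg (by omega), if_neg (by omega)]
    have hst : ∀ k ≤ n, st (dig N e) δ k = st (dig N e) (graft (dig N e) ε₀ (n - s)) k :=
      st_congr fun j _ hj => hlow j hj
    have hstn : st (dig N e) δ n = s := by
      have := htail.st_add s
      rwa [Nat.sub_add_cancel hs, ← hst n le_rfl] at this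
    refine ⟨δ, ⟨(hiff _ δ).mpr ⟨⟨?_, fun k => ?_⟩, st_succ_of_lt ?_, hhigh⟩, hstn⟩,
      Prod.ext (funext fun k => ?_) hmid⟩
    · rw [hlow 0 (Nat.zero_le _), htail.1.1]
    · rcases lt_trichotomy k n with hk | rfl | hk
      · rw [hlow _ hk, hst k hk.le]
        exact htail.1.2 k
      · rw [hmid, hstn]
        exact h2.le
      · rw [hhigh _ (by omega)]
        exact Nat.zero_le _
    · rwa [hmid, hstn]
    · dsimp only
      rw [res]
      split_ifs with hk
      · rw [hlow k (by omega), graft_of_le hk]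
      · exact (h5 k (by omega)).symm

theorem blockCount_succ (hN : 0 < N) (he : e 1 ≠ 0) (n : ℕ) :
    blockCount N e (n + 1) =
      ∑ s ∈ Finset.range (n + 1), dig N e s * blockCount N e (n - s) := by
  have hfin := blockSums_finite hN he (n + 1)
  rw [blockCount, Set.ncard_eq_toFinset_card _ hfin,
    Finset.card_eq_sum_card_fiberwise (f := fun ε => st (dig N e) ε n) (t := Finset.range (n + 1))
      fun ε _ => by
        rw [Finset.mem_coe, Finset.mem_range]
        exact Nat.lt_succ_of_le (st_le n)]
  refine Finset.sum_congr rfl fun s hs => ?_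
  rw [← ncard_blockSums_fiber he (Nat.lt_succ_iff.mp (Finset.mem_range.mp hs)),
    ← Set.ncard_coe_finset]
  congr 1
  ext ε
  simp

theorem blockCount_eq_of_le (hN : 0 < N) (he : e 1 ≠ 0) {k : ℕ} (h1 : 1 ≤ k) (h2 : k ≤ N) :
    blockCount N e k = ∑ j ∈ Finset.Icc 1 k, e j * blockCount N e (k - j) := by
  obtain ⟨n, rfl⟩ : ∃ n, k = n + 1 := ⟨k - 1, by omega⟩
  rw [blockCount_succ hN he, sum_Icc_one_eq]
  refine Finset.sum_congr rfl fun s hs => ?_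
  rw [dig, Nat.mod_eq_of_lt (by have := Finset.mem_range.mp hs; omega), Nat.add_sub_add_right]

theorem blockCount_eq_of_lt (hN : 0 < N) (he : e 1 ≠ 0) {n : ℕ} (h : N + 1 ≤ n) :
    blockCount N e n = ∑ k ∈ Finset.Icc 1 (N - 1), e k * blockCount N e (n - k) +
      (1 + e N) * blockCount N e (n - N) := by
  obtain ⟨m, rfl⟩ : ∃ m, n = N + m + 1 := ⟨n - N - 1, by omega⟩
  obtain ⟨L, rfl⟩ : ∃ L, N = L + 1 := ⟨N - 1, by omega⟩
  -- By periodicity the terms of the renewal sum from index `N` on form the renewal sum for C_{n-N}.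
  -- That needs `n - N ≥ 1`, as C_0 satisfies no renewal equation.
  have h1 : ∑ s ∈ Finset.range (m + 1),
      dig (L + 1) e (L + 1 + s) * blockCount (L + 1) e (L + 1 + m - (L + 1 + s)) =
      blockCount (L + 1) e (m + 1) := by
    rw [blockCount_succ hN he]
    refine Finset.sum_congr rfl fun s _ => ?_
    rw [dig, dig, Nat.add_mod_left, Nat.add_sub_add_left]
  have h2 : ∑ s ∈ Finset.range (L + 1), dig (L + 1) e s * blockCount (L + 1) e (L + 1 + m - s) =
      ∑ s ∈ Finset.range (L + 1), e (s + 1) * blockCount (L + 1) e (L + 1 + m - s) :=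
    Finset.sum_congr rfl fun s hs => by
      rw [dig, Nat.mod_eq_of_lt (Finset.mem_range.mp hs)]
  rw [blockCount_succ hN he, show L + 1 + m + 1 = L + 1 + (m + 1) by ring, Finset.sum_range_add,
    h1, h2, sum_Icc_one_eq, Nat.add_sub_cancel, Finset.sum_range_succ,
    show L + 1 + m - L = m + 1 by omega, show L + 1 + (m + 1) - (L + 1) = m + 1 by omega]
  simp only [show ∀ j, L + 1 + (m + 1) - (j + 1) = L + 1 + m - j from fun j => by omega]
  ring

/-! ### The generating function -/

theorem tailVal_maxBlock_lt_one (hN : 0 < N) {y : ℝ} (h0 : 0 ≤ y) (h1 : y < 1)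
    (hf : 0 < charFun N e y) : tailVal y (maxBlock N e 1) 0 < 1 := by
  have h2 := tailVal_maxBlock_mul (e := e) hN (x := y) (by rwa [abs_of_nonneg h0])
  have h3 : y ^ N < 1 := pow_lt_one₀ h0 h1 (by omega)
  by_contra! hge
  nlinarith

theorem summable_dig_mul_pow (hN : 0 < N) {x : ℝ} (hx : |x| < 1) :
    Summable fun j => (dig N e j : ℝ) * x ^ (j + 1) := by
  obtain ⟨K, hK⟩ := exists_dig_le (e := e) hN
  refine (summable_tailVal hx (top_le hK) 0).congr fun j => ?_
  rw [show 0 + 1 + j = j + 1 by ring, top_succ]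

theorem tsum_dig_mul_pow (x : ℝ) :
    ∑' j, (dig N e j : ℝ) * x ^ (j + 1) = tailVal x (maxBlock N e 1) 0 :=
  tsum_congr fun j => by rw [← top_dig, show 0 + 1 + j = j + 1 by ring, top_succ]

theorem blockCount_succ_mul_pow (hN : 0 < N) (he : e 1 ≠ 0) (x : ℝ) (n : ℕ) :
    (blockCount N e (n + 1) : ℝ) * x ^ (n + 1) = ∑ s ∈ Finset.range (n + 1),
      ((dig N e s : ℝ) * x ^ (s + 1)) * ((blockCount N e (n - s) : ℝ) * x ^ (n - s)) := by
  rw [blockCount_succ hN he]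
  push_cast
  rw [Finset.sum_mul]
  refine Finset.sum_congr rfl fun s hs => ?_
  have : n + 1 = (s + 1) + (n - s) := by have := Finset.mem_range.mp hs; omega
  rw [this, pow_add]
  ring

/-- By the renewal equation the partial sums satisfy P_{n+1} ≤ 1 + g P_n with g < 1, so they stay
below 1/(1-g). -/
theorem summable_blockCount (hN : 0 < N) (he : e 1 ≠ 0) {y : ℝ} (h0 : 0 ≤ y) (h1 : y < 1)
    (hf : 0 < charFun N e y) : Summable fun k => (blockCount N e k : ℝ) * y ^ k := by
  have hg := tailVal_maxBlock_lt_one hN h0 h1 hf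
  have hs := summable_dig_mul_pow (e := e) hN (x := y) (by rwa [abs_of_nonneg h0])
  have hnn : ∀ k, 0 ≤ (blockCount N e k : ℝ) * y ^ k := fun k => by positivity
  have hbn : ∀ k, 0 ≤ (dig N e k : ℝ) * y ^ (k + 1) := fun k => by positivity
  refine summable_of_sum_range_le (c := 1 / (1 - tailVal y (maxBlock N e 1) 0)) hnn fun n => ?_
  rw [le_div_iff₀ (by linarith)]
  induction n with
  | zero => simp
  | succ n ih =>
    have hP : 0 ≤ ∑ k ∈ Finset.range n, (blockCount N e k : ℝ) * y ^ k :=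
      Finset.sum_nonneg fun k _ => hnn k
    have hle : ∑ k ∈ Finset.range n, (blockCount N e (k + 1) : ℝ) * y ^ (k + 1) ≤
        tailVal y (maxBlock N e 1) 0 * ∑ k ∈ Finset.range n, (blockCount N e k : ℝ) * y ^ k := by
      rw [Finset.sum_congr rfl fun k _ => blockCount_succ_mul_pow hN he y k,
        Finset.sum_range_diag_flip n fun s k =>
          ((dig N e s : ℝ) * y ^ (s + 1)) * ((blockCount N e k : ℝ) * y ^ k)]
      calc _ ≤ ∑ s ∈ Finset.range n, ((dig N e s : ℝ) * y ^ (s + 1)) *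
            ∑ k ∈ Finset.range n, (blockCount N e k : ℝ) * y ^ k := by
            refine Finset.sum_le_sum fun s _ => ?_
            rw [← Finset.mul_sum]
            refine mul_le_mul_of_nonneg_left ?_ (hbn s)
            exact Finset.sum_le_sum_of_subset_of_nonneg
              (Finset.range_mono (Nat.sub_le n s)) fun k _ _ => hnn k
        _ ≤ _ := by
            rw [← Finset.sum_mul, ← tsum_dig_mul_pow]
            exact mul_le_mul_of_nonneg_right (hs.sum_le_tsum _ fun s _ => hbn s) hP
    rw [Finset.sum_range_succ', blockCount_zero he]
    simp only [Nat.cast_one, pow_zero, mul_one]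
    have hg0 : 0 ≤ tailVal y (maxBlock N e 1) 0 := tsum_nonneg fun j => by positivity
    have h2 := mul_le_mul_of_nonneg_right hle (sub_nonneg.mpr hg.le)
    have h3 := mul_le_mul_of_nonneg_left ih hg0
    linarith

theorem hasSum_blockCount (hN : 0 < N) (he : e 1 ≠ 0) {x : ℝ} (h1 : |x| < 1)
    (hf : 0 < charFun N e |x|) : charFun N e x ≠ 0 ∧
      HasSum (fun k => (blockCount N e k : ℝ) * x ^ k) ((1 - x ^ N) / charFun N e x) := by
  have hnorm : Summable fun k => ‖(blockCount N e k : ℝ) * x ^ k‖ := by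
    refine (summable_blockCount hN he (abs_nonneg x) h1 hf).congr fun k => ?_
    rw [norm_mul, norm_pow, Real.norm_eq_abs, Real.norm_eq_abs, Nat.abs_cast]
  have hnorm' : Summable fun j => ‖(dig N e j : ℝ) * x ^ (j + 1)‖ := by
    refine (summable_dig_mul_pow (e := e) hN (x := |x|) (by rwa [abs_abs])).congr fun k => ?_
    rw [norm_mul, norm_pow, Real.norm_eq_abs, Real.norm_eq_abs, Nat.abs_cast]
  have hmul := tsum_mul_tsum_eq_tsum_sum_range_of_summable_norm hnorm' hnorm
  have hzero := hnorm.of_norm.tsum_eq_zero_add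
  rw [tsum_congr fun n => blockCount_succ_mul_pow hN he x n, ← hmul, tsum_dig_mul_pow,
    blockCount_zero he, Nat.cast_one, pow_zero, mul_one] at hzero
  have hchar := tailVal_maxBlock_mul (e := e) hN h1
  set A := ∑' k, (blockCount N e k : ℝ) * x ^ k
  -- The Cauchy product gives A = 1 + gA; multiplication by 1-x^N eliminates g. As 1-x^N is
  -- positive, this also shows that f does not vanish.
  have hA : charFun N e x * A = 1 - x ^ N := by
    linear_combination (1 - x ^ N) * hzero + A * hchar
  have hx : x ^ N < 1 := by
    refine (le_abs_self _).trans_lt ?_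
    rw [abs_pow]
    exact pow_lt_one₀ (abs_nonneg x) h1 (by omega)
  have hne : charFun N e x ≠ 0 := by
    intro h
    rw [h, zero_mul] at hA
    linarith
  refine ⟨hne, ?_⟩
  rw [← hA, mul_div_cancel_left₀ _ hne]
  exact hnorm.of_norm.hasSum

theorem charFun_anti (hN : 0 < N) {x y : ℝ} (hx : 0 ≤ x) (hxy : x ≤ y) :
    charFun N e y ≤ charFun N e x := by
  rw [charFun_eq hN, charFun_eq hN]
  have h1 : x ^ N ≤ y ^ N := pow_le_pow_left₀ hx hxy N
  have h2 : ∑ j ∈ Finset.range N, (e (j + 1) : ℝ) * x ^ (j + 1) ≤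
      ∑ j ∈ Finset.range N, (e (j + 1) : ℝ) * y ^ (j + 1) := by
    gcongr
  linarith

theorem continuous_charFun : Continuous (charFun N e) := by
  unfold charFun
  fun_prop

theorem exists_radius (hN : 0 < N) (he : e 1 ≠ 0) {ω : ℝ} (h1 : ω < 1)
    (hf : 0 < charFun N e ω) : ∃ r : ℝ, ω < r ∧ ∀ x : ℝ, |x| < r → charFun N e x ≠ 0 ∧
      HasSum (fun k => (blockCount N e k : ℝ) * x ^ k) ((1 - x ^ N) / charFun N e x) := by
  have hev : ∀ᶠ y in 𝓝[>] ω, 0 < charFun N e y :=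
    ((continuous_charFun.tendsto ω).eventually (lt_mem_nhds hf)).filter_mono nhdsWithin_le_nhds
  obtain ⟨r, hr, hr1, hr2⟩ := (hev.and (Ioo_mem_nhdsGT h1)).exists
  refine ⟨r, hr1, fun x hx => hasSum_blockCount hN he (hx.trans hr2) ?_⟩
  exact hr.trans_le (charFun_anti hN (abs_nonneg x) hx.le)

end Counting

end Zeck

namespace Zeck

/-! ### The gaps of the smaller collection -/

section Gaps

variable {N M : ℕ} {e e' : ℕ → ℕ} {ω : ℝ} {ε : ℕ → ℕ} {b : ℕ}

theorem tails_eq_image (he : e 1 ≠ 0) (b : ℕ) :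
    {ε | IsTail (dig N e) ε b} = (fun ε₀ => ε₀ + maxBlock N e (b + 1)) '' blockSums N e b := by
  ext ε
  constructor
  · intro h
    have := (isTail_iff (dig_pos he)).mpr ⟨h, rfl⟩
    exact ⟨_, this.1, this.2.symm⟩
  · rintro ⟨ε₀, h, rfl⟩
    exact ((isTail_iff (dig_pos he)).mp ⟨h, rfl⟩).1

theorem ncard_tails (he : e 1 ≠ 0) (b : ℕ) :
    {ε | IsTail (dig N e) ε b}.ncard = blockCount N e b := by
  rw [tails_eq_image he, Set.ncard_image_of_injective _ (add_left_injective _), blockCount]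

theorem finite_tails (hN : 0 < N) (he : e 1 ≠ 0) (b : ℕ) :
    {ε | IsTail (dig N e) ε b}.Finite := by
  rw [tails_eq_image he]
  exact (blockSums_finite hN he b).image _

theorem starClosure_diff_eq (hN : 2 ≤ N) (he : e 1 ≠ 0) :
    starClosure N e \ starColl N e = ⋃ b, {ε | IsTail (dig N e) ε b} := by
  ext ε
  rw [mem_starClosure_diff_iff hN he, Set.mem_iUnion]
  rfl

theorem countable_starClosure_diff (hN : 2 ≤ N) (he : e 1 ≠ 0) :
    (starClosure N e \ starColl N e).Countable := by
  rw [starClosure_diff_eq hN he]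
  exact Set.countable_iUnion fun b => (finite_tails (by omega) he b).countable

variable (hN : 2 ≤ N) (he : e 1 ≠ 0) (hM : 2 ≤ M) (he' : e' 1 ≠ 0)
  (hbase : IsBase (dig M e') ω)
  (H : ∀ τ p, IsAcceptedUpTo (dig N e) τ p → IsAcceptedUpTo (dig M e') τ p)
include hN he hbase H

theorem rightEnd_sub_leftEnd (h : IsTail (dig N e) ε b) :
    rightEnd N e ω ε - leftEnd ω ε = ω ^ b * (1 - rho N e ω) := by
  rw [rightEnd_eq he h, leftEnd, h.right_sub_left hbase H, rho_eq (by omega) hbase.abs_lt, top_dig]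

omit he in
theorem rho_lt_one (hne : maxBlock N e 1 ≠ maxBlock M e' 1) : rho N e ω < 1 := by
  rw [rho_eq (by omega) hbase.abs_lt]
  exact tailVal_top_lt_one hbase H hne

theorem pairwiseDisjoint_gaps : (starClosure N e \ starColl N e).PairwiseDisjoint
    (fun ε => Ioo (leftEnd ω ε) (rightEnd N e ω ε)) := by
  intro ε hε δ hδ hne
  obtain ⟨b, h⟩ := (mem_starClosure_diff_iff hN he).mp hε
  obtain ⟨b', h'⟩ := (mem_starClosure_diff_iff hN he).mp hδ
  simp only [Function.onFun, rightEnd_eq he h, rightEnd_eq he h', leftEnd]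
  exact h.disjoint_Ioo hbase H h' hne

include hM he'

/-- Every point of `(0, 1)` is a value of the larger collection, and values of the closure avoid the
gap, so a point of the gap can only come from outside the closure. -/
theorem gap_subset_setU (hε : ε ∈ starClosure N e \ starColl N e) :
    Ioo (leftEnd ω ε) (rightEnd N e ω ε) ⊆
      setU N e M e' ω \ (leftEnd ω '' (starClosure N e \ starColl N e)) := by
  obtain ⟨b, h⟩ := (mem_starClosure_diff_iff hN he).mp hε
  rw [rightEnd_eq he h, leftEnd]
  rintro x ⟨h1, h2⟩
  refine ⟨?_, ?_⟩
  · have h3 := h.right_le_one hbase H hbase.inf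
    have h4 : 0 ≤ eval (powers ω) ε := by
      rw [hbase.eval_eq (h.1.of_imp H)]
      exact tailVal_nonneg hbase.ω_pos 0
    obtain ⟨τ, hτ, rfl⟩ := (isFundamentalSequence_powers hM he' hbase).bij.surjOn
      (show x ∈ Ioo (0 : ℝ) 1 from ⟨by linarith, by linarith⟩)
    refine ⟨τ, ⟨hτ, fun hcl => ?_⟩, rfl⟩
    exact h.eval_notMem_Ioo hbase H ((mem_starClosure_iff hN he).mp hcl).2 ⟨h1, h2⟩
  · rintro ⟨δ, hδ, rfl⟩
    exact h.eval_notMem_Ioo hbase H ((mem_starClosure_iff hN he).mp hδ.1).2 ⟨h1, h2⟩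

omit hM he' in
theorem exists_gap_of_mem {τ : ℕ → ℕ} (hτ : τ ∈ starColl M e' \ starClosure N e) :
    ∃ ε ∈ starClosure N e \ starColl N e, DescLT ε τ ∧ leftEnd ω ε ≤ eval (powers ω) τ ∧
      eval (powers ω) τ < rightEnd N e ω ε := by
  obtain ⟨h1, h2, h3⟩ := (mem_starColl_iff hbase.pos hbase.inf).mp hτ.1
  obtain ⟨ε, b, h, hlt, hr⟩ := exists_isTail_of_not_isAccepted hbase H h2 h3
    fun hacc => hτ.2 ((mem_starClosure_iff hN he).mpr ⟨h1, hacc⟩)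
  exact ⟨ε, (mem_starClosure_diff_iff hN he).mpr ⟨b, h⟩, hlt,
    (hbase.eval_le_of_descLT (h.1.of_imp H) h2 hlt).1, by rwa [rightEnd_eq he h]⟩

theorem setU_diff_eq :
    setU N e M e' ω \ (leftEnd ω '' (starClosure N e \ starColl N e)) =
      ⋃ ε ∈ starClosure N e \ starColl N e, Ioo (leftEnd ω ε) (rightEnd N e ω ε) := by
  refine Set.Subset.antisymm ?_
    (Set.iUnion₂_subset fun ε hε => gap_subset_setU hN he hM he' hbase H hε)
  rintro _ ⟨⟨τ, hτ, rfl⟩, hno⟩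
  obtain ⟨ε, hε, -, hl, hr⟩ := exists_gap_of_mem hN he hbase H hτ
  refine Set.mem_iUnion₂.mpr ⟨ε, hε, lt_of_le_of_ne hl fun heq => hno ⟨ε, hε, heq⟩, hr⟩

theorem setU_eq (htop : maxBlock N e 1 ∈ starColl M e') :
    setU N e M e' ω =
      ⋃ ε ∈ starClosure N e \ starColl N e, Ioo (leftEnd ω ε) (rightEnd N e ω ε) := by
  refine Set.Subset.antisymm ?_ (Set.iUnion₂_subset fun ε hε =>
    (gap_subset_setU hN he hM he' hbase H hε).trans Set.sdiff_subset)
  rintro _ ⟨τ, hτ, rfl⟩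
  obtain ⟨ε, hε, hlt, hl, hr⟩ := exists_gap_of_mem hN he hbase H hτ
  obtain ⟨b, h⟩ := (mem_starClosure_diff_iff hN he).mp hε
  have hinf := ((mem_starColl_iff hbase.pos hbase.inf).mp htop).2.2
  have hτ' := ((mem_starColl_iff hbase.pos hbase.inf).mp hτ.1).2.1
  exact Set.mem_iUnion₂.mpr ⟨ε, hε, (hbase.eval_le_of_descLT (h.1.of_imp H) hτ' hlt).2
    (h.exists_st_eq_zero H hinf), hr⟩

theorem measurableSet_setU : MeasurableSet (setU N e M e' ω) := by
  have hc := (countable_starClosure_diff hN he).image (leftEnd ω)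
  rw [← Set.sdiff_union_inter (setU N e M e' ω) (leftEnd ω '' (starClosure N e \ starColl N e)),
    setU_diff_eq hN he hM he' hbase H]
  exact ((isOpen_biUnion fun ε _ => isOpen_Ioo).measurableSet).union
    (hc.mono Set.inter_subset_right).measurableSet

omit hM he' in
theorem volume_tails_gaps (b : ℕ) :
    volume (⋃ ε ∈ {ε | IsTail (dig N e) ε b}, Ioo (leftEnd ω ε) (rightEnd N e ω ε)) =
      ENNReal.ofReal (blockCount N e b * gapLength N e ω b) := by
  have hfin := finite_tails (N := N) (by omega) he b
  have hsub : {ε | IsTail (dig N e) ε b} ⊆ starClosure N e \ starColl N e := fun ε hε =>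
    (mem_starClosure_diff_iff hN he).mpr ⟨b, hε⟩
  rw [measure_biUnion hfin.countable ((pairwiseDisjoint_gaps hN he hbase H).subset hsub)
    fun ε _ => measurableSet_Ioo]
  rw [tsum_congr (g := fun _ => ENNReal.ofReal (gapLength N e ω b)) fun ε => by
    rw [Real.volume_Ioo, rightEnd_sub_leftEnd hN he hbase H ε.2, gapLength_eq hN hbase.abs_lt],
    ENNReal.tsum_const, ENNReal.ofReal_mul (Nat.cast_nonneg _), ENNReal.ofReal_natCast,
    ← ncard_tails he b]
  congr 1
  rw [← ENat.toENNReal_coe, hfin.cast_ncard_eq]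
  rfl

theorem volume_setU {c : ℝ} (hρ : rho N e ω < 1)
    (hsum : HasSum (fun b => (blockCount N e b : ℝ) * gapLength N e ω b) c) :
    volume (setU N e M e' ω) = ENNReal.ofReal c := by
  have hc := (countable_starClosure_diff hN he).image (leftEnd ω)
  rw [← measure_sdiff_null (hc.measure_zero volume), setU_diff_eq hN he hM he' hbase H,
    starClosure_diff_eq hN he, Set.biUnion_iUnion, measure_iUnion, tsum_congr
    fun b => volume_tails_gaps hN he hbase H b, ← ENNReal.ofReal_tsum_of_nonneg _ hsum.summable,
    hsum.tsum_eq]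
  · intro b
    rw [gapLength_eq hN hbase.abs_lt]
    have := hbase.ω_pos
    have : 0 < 1 - rho N e ω := by linarith
    positivity
  · intro b b' hne
    simp only [Function.onFun, Set.disjoint_iUnion_left, Set.disjoint_iUnion_right]
    intro ε hε δ hδ
    refine pairwiseDisjoint_gaps hN he hbase H ((mem_starClosure_diff_iff hN he).mpr ⟨_, hδ⟩)
      ((mem_starClosure_diff_iff hN he).mpr ⟨_, hε⟩) ?_
    rintro rfl
    exact hne (IsTail.index_unique hδ hε)
  · exact fun b => (isOpen_biUnion fun ε _ => isOpen_Ioo).measurableSet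

omit hM he' in
theorem ncard_gaps (hρ : rho N e ω < 1) (b : ℕ) :
    {ε ∈ starClosure N e \ starColl N e |
      rightEnd N e ω ε - leftEnd ω ε = gapLength N e ω b}.ncard = blockCount N e b := by
  rw [← ncard_tails he b]
  congr 1
  ext ε
  rw [Set.mem_sep_iff, gapLength_eq hN hbase.abs_lt]
  constructor
  · rintro ⟨hε, heq⟩
    obtain ⟨b', h⟩ := (mem_starClosure_diff_iff hN he).mp hε
    rw [rightEnd_sub_leftEnd hN he hbase H h] at heq
    -- As ρ < 1, the length of a gap determines the power of `ω` and hence its level.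
    have hpow := mul_right_cancel₀ (sub_pos.mpr hρ).ne' heq
    have := pow_right_injective₀ hbase.ω_pos hbase.ω_lt.ne hpow
    exact this ▸ h
  · intro h
    exact ⟨(mem_starClosure_diff_iff hN he).mpr ⟨b, h⟩, rightEnd_sub_leftEnd hN he hbase H h⟩

end Gaps

end Zeck

/-! ### The main theorem -/

theorem mainTheorem5 (N M : ℕ) (e e' : ℕ → ℕ) (hN : 2 ≤ N) (hM : 2 ≤ M)
    (he : e 1 ≠ 0) (he' : e' 1 ≠ 0)
    (hsub : Zeck.coll N e ⊂ Zeck.coll M e')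
    (ω : ℝ) (hω : 0 < ω) (hroot : Zeck.charFun M e' ω = 0) :
    -- the powers of `ω` are a fundamental sequence of the larger collection
    Zeck.IsFundamentalSequence (Zeck.starColl M e') (Zeck.powers ω) ∧
    -- the decomposition `ε = ε₀ + \bar β^{b+1}` is unique, and `ε₀ + β^b` belongs to `E^*`
    (∀ ε ∈ Zeck.starClosure N e \ Zeck.starColl N e,
      (∃! p : ℕ × (ℕ → ℕ), p.2 ∈ Zeck.blockSums N e p.1 ∧
        ε = p.2 + Zeck.maxBlock N e (p.1 + 1)) ∧
      ∀ b, 1 ≤ b → ∀ ε₀ ∈ Zeck.blockSums N e b, ε = ε₀ + Zeck.maxBlock N e (b + 1) →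
        ε₀ + Zeck.basis b ∈ Zeck.starColl N e) ∧
    -- the intervals are non-empty and pairwise disjoint
    (∀ ε ∈ Zeck.starClosure N e \ Zeck.starColl N e,
      Zeck.leftEnd ω ε < Zeck.rightEnd N e ω ε) ∧
    (Zeck.starClosure N e \ Zeck.starColl N e).PairwiseDisjoint
      (fun ε => Set.Ioo (Zeck.leftEnd ω ε) (Zeck.rightEnd N e ω ε)) ∧
    -- `U` is their union, up to left end points if `\bar β^1` is not in the larger collection
    Zeck.setU N e M e' ω \ (Zeck.leftEnd ω '' (Zeck.starClosure N e \ Zeck.starColl N e)) =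
      ⋃ ε ∈ Zeck.starClosure N e \ Zeck.starColl N e,
        Set.Ioo (Zeck.leftEnd ω ε) (Zeck.rightEnd N e ω ε) ∧
    (Zeck.maxBlock N e 1 ∈ Zeck.starColl M e' →
      Zeck.setU N e M e' ω = ⋃ ε ∈ Zeck.starClosure N e \ Zeck.starColl N e,
        Set.Ioo (Zeck.leftEnd ω ε) (Zeck.rightEnd N e ω ε) ∧
      IsOpen (Zeck.setU N e M e' ω)) ∧
    -- the measure of `U`
    MeasurableSet (Zeck.setU N e M e' ω) ∧
    MeasureTheory.volume (Zeck.setU N e M e' ω) = 1 ∧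
    -- the recurrence for `C_n`
    (∀ n, (Zeck.blockSums N e n).Finite) ∧
    Zeck.blockCount N e 0 = 1 ∧
    (∀ k, 1 ≤ k → k ≤ N → Zeck.blockCount N e k =
      ∑ j ∈ Finset.Icc 1 k, e j * Zeck.blockCount N e (k - j)) ∧
    (∀ n, N + 1 ≤ n → Zeck.blockCount N e n =
      ∑ k ∈ Finset.Icc 1 (N - 1), e k * Zeck.blockCount N e (n - k) +
        (1 + e N) * Zeck.blockCount N e (n - N)) ∧
    -- the generating function, on an open interval that contains `0` and `ω`
    (∃ r : ℝ, ω < r ∧ ∀ x : ℝ, |x| < r → Zeck.charFun N e x ≠ 0 ∧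
      HasSum (fun k => (Zeck.blockCount N e k : ℝ) * x ^ k)
        ((1 - x ^ N) / Zeck.charFun N e x)) ∧
    -- exactly `C_b` of the intervals have length `I_b = ω^b (1 - ρ)`, every length is of this form
    (∀ b, Zeck.gapLength N e ω b = ω ^ b * (1 - Zeck.rho N e ω)) ∧
    (∀ ε ∈ Zeck.starClosure N e \ Zeck.starColl N e,
      Zeck.rightEnd N e ω ε - Zeck.leftEnd ω ε =
        Zeck.gapLength N e ω (Zeck.tailIndex N e ε)) ∧
    (∀ b, {ε ∈ Zeck.starClosure N e \ Zeck.starColl N e |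
      Zeck.rightEnd N e ω ε - Zeck.leftEnd ω ε = Zeck.gapLength N e ω b}.ncard =
        Zeck.blockCount N e b) ∧
    -- the total length
    HasSum (fun b => (Zeck.blockCount N e b : ℝ) * Zeck.gapLength N e ω b)
      ((1 - Zeck.rho N e ω) * ((1 - ω ^ N) / Zeck.charFun N e ω)) ∧
    (1 - Zeck.rho N e ω) * ((1 - ω ^ N) / Zeck.charFun N e ω) = 1 := by
  have hB' := Zeck.dig_pos (N := M) he'
  have hbase := Zeck.isBase_dig hM he' hω hroot
  have H : ∀ τ p, Zeck.IsAcceptedUpTo (Zeck.dig N e) τ p → Zeck.IsAcceptedUpTo (Zeck.dig M e') τ p :=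
    fun τ p h => h.of_coll_subset hB' hsub.1
  have hne : Zeck.maxBlock N e 1 ≠ Zeck.maxBlock M e' 1 := fun h =>
    hsub.ne (Zeck.coll_eq_of_maxBlock_eq h)
  have hρ := Zeck.rho_lt_one hN hbase H hne
  have hpow : 0 < 1 - ω ^ N := sub_pos.mpr (pow_lt_one₀ hω.le hbase.ω_lt (by omega))
  -- The factorization of f at `ω`; it yields both the positivity of f there and the total length 1.
  have hchar : Zeck.charFun N e ω = (1 - Zeck.rho N e ω) * (1 - ω ^ N) := by
    rw [Zeck.rho_eq (by omega) hbase.abs_lt]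
    linear_combination Zeck.tailVal_maxBlock_mul (e := e) (by omega) hbase.abs_lt (N := N)
  have hpos : 0 < Zeck.charFun N e ω := by
    rw [hchar]
    exact mul_pos (sub_pos.mpr hρ) hpow
  have htotal : (1 - Zeck.rho N e ω) * ((1 - ω ^ N) / Zeck.charFun N e ω) = 1 := by
    rw [← mul_div_assoc, ← hchar, div_self hpos.ne']
  have hsum : HasSum (fun b => (Zeck.blockCount N e b : ℝ) * Zeck.gapLength N e ω b)
      ((1 - Zeck.rho N e ω) * ((1 - ω ^ N) / Zeck.charFun N e ω)) := by
    have := (Zeck.hasSum_blockCount (N := N) (by omega) he hbase.abs_lt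
      (by rwa [abs_of_pos hω])).2.mul_left (1 - Zeck.rho N e ω)
    have heq : (fun b => (Zeck.blockCount N e b : ℝ) * Zeck.gapLength N e ω b) =
        fun b => (1 - Zeck.rho N e ω) * ((Zeck.blockCount N e b : ℝ) * ω ^ b) := funext fun b => by
      rw [Zeck.gapLength_eq hN hbase.abs_lt]
      ring
    rwa [heq]
  have hlen : ∀ ε ∈ Zeck.starClosure N e \ Zeck.starColl N e,
      Zeck.rightEnd N e ω ε - Zeck.leftEnd ω ε =
        Zeck.gapLength N e ω (Zeck.tailIndex N e ε) := fun ε hε => by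
    obtain ⟨b, h⟩ := (Zeck.mem_starClosure_diff_iff hN he).mp hε
    rw [Zeck.rightEnd_sub_leftEnd hN he hbase H h, Zeck.tailIndex_eq he h,
      Zeck.gapLength_eq hN hbase.abs_lt]
  have hUeq := Zeck.setU_eq hN he hM he' hbase H
  refine ⟨Zeck.isFundamentalSequence_powers hM he' hbase,
    fun ε hε => Zeck.isTail_unique_and_mem hN he hε, fun ε hε => ?_,
    Zeck.pairwiseDisjoint_gaps hN he hbase H, Zeck.setU_diff_eq hN he hM he' hbase H,
    fun htop => ⟨hUeq htop, ?_⟩, Zeck.measurableSet_setU hN he hM he' hbase H, ?_,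
    Zeck.blockSums_finite (by omega) he, Zeck.blockCount_zero he,
    fun k h1 h2 => Zeck.blockCount_eq_of_le (by omega) he h1 h2,
    fun n hn => Zeck.blockCount_eq_of_lt (by omega) he hn,
    Zeck.exists_radius (by omega) he hbase.ω_lt hpos, Zeck.gapLength_eq hN hbase.abs_lt, hlen,
    Zeck.ncard_gaps hN he hbase H hρ, hsum, htotal⟩
  · have h1 := hlen ε hε
    rw [Zeck.gapLength_eq hN hbase.abs_lt] at h1
    have h2 := mul_pos (pow_pos hω (Zeck.tailIndex N e ε)) (sub_pos.mpr hρ)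
    linarith
  · rw [hUeq htop]
    exact isOpen_biUnion fun ε _ => isOpen_Ioo
  · rw [Zeck.volume_setU hN he hM he' hbase H hρ hsum, htotal, ENNReal.ofReal_one]
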